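/- An MV-algebra is an algebra $(M;\oplus,{}^*,0)$ such that $(M;\oplus,0)$ is a commutative monoid and, with $1:=0^*$, for all $x,y\in M$: $(x^*)^*=x$, $x\oplus 1=1$ and $x\oplus(x\oplus y^*)^*=y\oplus(y\oplus x^*)^*$. It is ordered by $x\le y$ iff $x^*\oplus y=1$, and it is $\sigma$-complete if every sequence has a supremum and an infimum. The partial sum $a+b$ is defined iff $a\le b^*$, and then $a+b:=a\oplus b$. A state on $M$ is a map $s:M\to[0,1]$ with $s(1)=1$ and $s(a+b)=s(a)+s(b)$ whenever $a+b$ is defined; it is $\sigma$-additive if $s(a)=\lim_n s(a_n)$ whenever $a_1\le a_2\le\cdots$ and $a=\bigvee_n a_n$. An element $e\in M$ is central if there is an isomorphism $\varphi:M\to[0,e]\times[0,e^*]$ with respect to the partial sums and units (the sum on $[0,e]$ being the restriction of $+$, and its unit being $e$; likewise for $[0,e^*]$) such that $\varphi(e)=(e,0)$ and such that $\varphi(x)=(x_1,x_2)$ implies $x=x_1+x_2$. A tribe on a set $X\neq\emptyset$ is a set $\mathcal T\subseteq[0,1]^X$ such that $1\in\mathcal T$, $1-f\in\mathcal T$ for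 $f\in\mathcal T$, and $\min\{\sum_{n=1}^\infty f_n,1\}\in\mathcal T$ for every sequence $(f_n)$ in $\mathcal T$; it is an MV-algebra with $f\oplus g=\min\{f+g,1\}$, $f^*=1-f$ and the pointwise order. Put $$\mathcal S_0(\mathcal T)=\{A\subseteq X:\chi_A\in\mathcal T\},\qquad \mathcal B_0(\mathcal T)=\{A\subseteq X:\chi_A \text{ is a central element of }\mathcal T\}.$$ A $\sigma$-MV-homomorphism is a map between MV-algebras that preserves $\oplus$, ${}^*$, $0$ and all existing countable suprema. **Theorem.** Let $s$ be a $\sigma$-additive state on a $\sigma$-complete MV-algebra $M$. Then there are a set $X\ne\emptyset$, a tribe $\mathcal T$ of functions on $X$ and a $\sigma$-MV-homomorphism $h$ from $\mathcal T$ onto $M$ such that $\mathcal B_0(\mathcal T)=\mathcal S_0(\mathcal T)$ is a $\sigma$-algebra of subsets of $X$, every $f\in\mathcal T$ is $\mathcal B_0(\mathcal T)$-measurable, and there is a unique $\sigma$-additive probability measure $\mu_s$ on $\mathcal B_0(\mathcal T)$ with $$s(a)=\int_X f(x)\,d\mu_s(x)\qquad\text{for all } a\in M \text{ and all } f\in\mathcal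 T \text{ with } h(f)=a.$$ -/

import Mathlib

open scoped unitInterval MeasureTheory

universe u

/-- An MV-algebra `(M; ⊕, *, 0)`, where `1 := 0*`. The order is not additional data: it is
determined by the operations through `le_iff` (that `x* ⊕ y = 1` is always a partial order is
`MVAlgebra.ofAxioms` below); it is a field only so that algebras of functions carry their
pointwise order definitionally. -/
class MVAlgebra (M : Type*) extends PartialOrder M where
  oplus : M → M → M
  neg : M → M
  zero : M
  oplus_assoc : ∀ x y z, oplus (oplus x y) z = oplus x (oplus y z)
  oplus_comm : ∀ x y, oplus x y = oplus y x
  oplus_zero : ∀ x, oplus x zero = x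
  neg_neg : ∀ x, neg (neg x) = x
  oplus_one : ∀ x, oplus x (neg zero) = neg zero
  luk : ∀ x y, oplus x (neg (oplus x (neg y))) = oplus y (neg (oplus y (neg x)))
  le_iff : ∀ x y, x ≤ y ↔ oplus (neg x) y = neg zero

namespace MVAlgebra

/-- The unit `1 = 0*`. -/
def one {M : Type*} [MVAlgebra M] : M := neg zero

/-- An algebra that satisfies just the algebraic axioms is an MV-algebra in the sense above. -/
abbrev ofAxioms {M : Type*} (oplus : M → M → M) (neg : M → M) (zero : M)
    (assoc : ∀ x y z, oplus (oplus x y) z = oplus x (oplus y z))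
    (comm : ∀ x y, oplus x y = oplus y x)
    (oplus_zero : ∀ x, oplus x zero = x)
    (neg_neg : ∀ x, neg (neg x) = x)
    (oplus_one : ∀ x, oplus x (neg zero) = neg zero)
    (luk : ∀ x y, oplus x (neg (oplus x (neg y))) = oplus y (neg (oplus y (neg x)))) :
    MVAlgebra M where
  le x y := oplus (neg x) y = neg zero
  le_refl x := by
    have h := luk x (neg zero)
    rw [neg_neg, oplus_zero, comm (neg zero) (neg (oplus _ _)), oplus_one] at h
    rw [comm, h]
  le_trans x y z hxy hyz := by
    have h := luk z y
    rw [comm z (neg y), hyz, neg_neg, oplus_zero] at h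
    rw [h, ← assoc, hxy, comm, oplus_one]
  le_antisymm x y hxy hyx := by
    have h := luk x y
    rw [comm x (neg y), hyx, comm y (neg x), hxy, neg_neg, oplus_zero, oplus_zero] at h
    exact h
  oplus := oplus
  neg := neg
  zero := zero
  oplus_assoc := assoc
  oplus_comm := comm
  oplus_zero := oplus_zero
  neg_neg := neg_neg
  oplus_one := oplus_one
  luk := luk
  le_iff _ _ := Iff.rfl

section

variable {M : Type*} [MVAlgebra M]

/-- The partial addition of the associated effect algebra: `a + b` is defined iff `a ≤ b*`, and
then it is `a ⊕ b`. `IsSum a b c` says that `a + b` is defined and equal to `c`. -/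
def IsSum (a b c : M) : Prop := a ≤ neg b ∧ oplus a b = c

/-- Central elements: there is an isomorphism of effect algebras `φ : M → [0,e] × [0,e*]` with
`φ e = (e, 0)` and such that `φ x = (x₁, x₂)` implies `x = x₁ + x₂`. The addition of `[0,e]` is the
restriction of that of `M`, its unit is `e`. -/
def IsCentral (e : M) : Prop :=
  ∃ φ : M ≃ Set.Iic e × Set.Iic (neg e),
    (((φ one).1 : M) = e ∧ ((φ one).2 : M) = neg e) ∧
    (∀ a b c : M, IsSum a b c ↔
      IsSum ((φ a).1 : M) (φ b).1 (φ c).1 ∧ IsSum ((φ a).2 : M) (φ b).2 (φ c).2) ∧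
    (((φ e).1 : M) = e ∧ ((φ e).2 : M) = zero) ∧
    ∀ x : M, IsSum ((φ x).1 : M) (φ x).2 x

/-- States on an MV-algebra. -/
structure IsState (s : M → ℝ) : Prop where
  mem_Icc : ∀ a, s a ∈ Set.Icc (0 : ℝ) 1
  map_one : s one = 1
  map_sum : ∀ a b c, IsSum a b c → s c = s a + s b

/-- σ-additive states: `aₙ ↗ a` implies `s a = lim s aₙ`. -/
structure IsSigmaAdditiveState (s : M → ℝ) : Prop extends IsState s where
  tendsto : ∀ (a : ℕ → M) (b : M), Monotone a → IsLUB (Set.range a) b →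
    Filter.Tendsto (fun n => s (a n)) Filter.atTop (nhds (s b))

end

/-- `M` is σ-complete: every sequence has a supremum and an infimum. -/
def IsSigmaComplete (M : Type*) [MVAlgebra M] : Prop :=
  ∀ a : ℕ → M, (∃ b, IsLUB (Set.range a) b) ∧ ∃ b, IsGLB (Set.range a) b

/-- σ-MV-homomorphisms: MV-homomorphisms that preserve (existing) countable suprema. -/
structure IsSigmaHom {M N : Type*} [MVAlgebra M] [MVAlgebra N] (h : M → N) : Prop where
  map_zero : h zero = zero
  map_neg : ∀ x, h (neg x) = neg (h x)
  map_oplus : ∀ x y, h (oplus x y) = oplus (h x) (h y)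
  map_sup : ∀ (a : ℕ → M) (b : M), IsLUB (Set.range a) b →
    IsLUB (Set.range fun n => h (a n)) (h b)

/-- The standard MV-algebra `[0,1]`: `x ⊕ y = min (x + y) 1`, `x* = 1 - x`. -/
noncomputable instance : MVAlgebra I where
  oplus x y := ⟨min ((x : ℝ) + y) 1, le_min (add_nonneg x.2.1 y.2.1) zero_le_one, min_le_right _ _⟩
  neg := unitInterval.symm
  zero := 0
  oplus_assoc x y z := by
    have := x.2.1; have := z.2.1
    ext; simp only
    grind
  oplus_comm x y := by ext; simp only [add_comm]
  oplus_zero x := by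
    ext; simpa using x.2.2
  neg_neg := unitInterval.symm_symm
  oplus_one x := by
    ext; simpa using x.2.1
  luk x y := by
    obtain ⟨x, hx0, hx1⟩ := x
    obtain ⟨y, hy0, hy1⟩ := y
    ext; simp only [unitInterval.coe_symm_eq]
    grind
  le_iff x y := by
    rw [← Subtype.coe_le_coe, Subtype.ext_iff]
    simp only [unitInterval.coe_symm_eq, Set.Icc.coe_zero]
    grind

/-- `[0,1]^X` with the pointwise operations and order. -/
noncomputable instance (X : Type*) : MVAlgebra (X → I) where
  oplus f g := fun x => oplus (f x) (g x)
  neg f := fun x => neg (f x)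
  zero := fun _ => zero
  oplus_assoc _ _ _ := funext fun _ => oplus_assoc _ _ _
  oplus_comm _ _ := funext fun _ => oplus_comm _ _
  oplus_zero _ := funext fun _ => oplus_zero _
  neg_neg _ := funext fun _ => neg_neg _
  oplus_one _ := funext fun _ => oplus_one _
  luk _ _ := funext fun _ => luk _ _
  le_iff f g := by
    rw [Pi.le_def, funext_iff]
    exact forall_congr' fun x => le_iff (f x) (g x)

end MVAlgebra

/-- `min (∑ₙ aₙ) 1`, the (possibly infinite) sum being taken in `[0,∞]`. -/
noncomputable def truncSum (a : ℕ → I) : I :=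
  ⟨(min (∑' n, ENNReal.ofReal (a n)) 1).toReal, ENNReal.toReal_nonneg,
    ENNReal.toReal_le_of_le_ofReal zero_le_one (by simp)⟩

/-- Tribes of `[0,1]`-valued functions on `X`. -/
structure Tribe (X : Type*) where
  carrier : Set (X → I)
  one_mem : (fun _ => 1) ∈ carrier
  symm_mem : ∀ f ∈ carrier, (fun x => unitInterval.symm (f x)) ∈ carrier
  truncSum_mem : ∀ f : ℕ → X → I, (∀ n, f n ∈ carrier) →
    (fun x => truncSum fun n => f n x) ∈ carrier

namespace Tribe

variable {X : Type*} (T : Tribe X)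

theorem zero_mem : (MVAlgebra.zero : X → I) ∈ T.carrier := by
  have h := T.symm_mem _ T.one_mem
  simp only [unitInterval.symm_one] at h
  exact h

theorem oplus_mem {f g : X → I} (hf : f ∈ T.carrier) (hg : g ∈ T.carrier) :
    MVAlgebra.oplus f g ∈ T.carrier := by
  have h := T.truncSum_mem
    (fun n => if n = 0 then f else if n = 1 then g else MVAlgebra.zero) (by
      intro n
      split_ifs
      · exact hf
      · exact hg
      · exact T.zero_mem)
  convert h using 1
  funext x
  apply Subtype.ext
  have hs : (∑' n : ℕ, ENNReal.ofReal (((if n = 0 then f else if n = 1 then g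
      else MVAlgebra.zero : X → I) x : I) : ℝ)) = ENNReal.ofReal ((f x : ℝ) + g x) := by
    rw [tsum_eq_sum (s := Finset.range 2)]
    · rw [Finset.sum_range_succ, Finset.sum_range_one, ENNReal.ofReal_add (f x).2.1 (g x).2.1]
      simp
    · intro n hn
      have h0 : n ≠ 0 := by rintro rfl; simp at hn
      have h1 : n ≠ 1 := by rintro rfl; simp at hn
      rw [if_neg h0, if_neg h1]
      show ENNReal.ofReal ((0 : I) : ℝ) = 0
      simp
  show min ((f x : ℝ) + g x) 1 = (min _ (1 : ENNReal)).toReal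
  rw [hs, ← ENNReal.ofReal_one, ← ENNReal.ofReal_min, ENNReal.toReal_ofReal]
  exact le_min (add_nonneg (f x).2.1 (g x).2.1) zero_le_one

/-- A tribe is an MV-algebra under the pointwise operations and order. -/
noncomputable instance : MVAlgebra T.carrier where
  oplus f g := ⟨MVAlgebra.oplus f.1 g.1, T.oplus_mem f.2 g.2⟩
  neg f := ⟨MVAlgebra.neg f.1, T.symm_mem _ f.2⟩
  zero := ⟨MVAlgebra.zero, T.zero_mem⟩
  oplus_assoc _ _ _ := Subtype.ext (MVAlgebra.oplus_assoc _ _ _)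
  oplus_comm _ _ := Subtype.ext (MVAlgebra.oplus_comm _ _)
  oplus_zero _ := Subtype.ext (MVAlgebra.oplus_zero _)
  neg_neg _ := Subtype.ext (MVAlgebra.neg_neg _)
  oplus_one _ := Subtype.ext (MVAlgebra.oplus_one _)
  luk _ _ := Subtype.ext (MVAlgebra.luk _ _)
  le_iff f g := by
    rw [Subtype.ext_iff]
    exact MVAlgebra.le_iff f.1 g.1

/-- The characteristic function of `A`. -/
noncomputable def chi (A : Set X) : X → I := A.indicator fun _ => 1

/-- `S₀(T) = {A ⊆ X : χ_A ∈ T}`. -/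
def S₀ : Set (Set X) := {A | chi A ∈ T.carrier}

/-- `B₀(T) = {A ⊆ X : χ_A is a central element of T}`. -/
def B₀ : Set (Set X) := {A | ∃ e : T.carrier, e.1 = chi A ∧ MVAlgebra.IsCentral e}

end Tribe

-- `M` is represented on the compact space `Spec M` of its homomorphisms to [0,1]. The tribe
-- consists of the functions that agree off a meagre set with an evaluation x ↦ x(a), and h sends
-- such a function to a. Once homomorphisms to [0,1] separate the elements of `M`, Baire's theorem
-- shows that the function determines a (`eq_of_eventually_eq`). That h preserves countable suprema
-- rests on suprema in `M` being pointwise off a meagre set (`eventually_isLUB`).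
--
-- Separation comes from σ-completeness, which excludes infinitesimals (`exists_isHom_ne_zero`). The
-- homomorphisms come from prime ideals: the quotient by one is a chain, and reading off binary
-- digits maps an MV-chain homomorphically to [0,1] (`val_neg`, `val_oplus`).
--
-- For the measure, s ∘ h is a σ-additive state on the tribe. On any tribe such a state t is
-- integration against A ↦ t(χ_A) (`existsUnique_measure`), because a state is determined by its
-- values at characteristic functions (`state_ext`); this follows by iterating 2t(f) = t(f ⊕ f) +
-- t(f ⊙ f). The same doubling gives measurability (`measurable_coe`). Finally B₀ = S₀ in every
-- tribe, since restricting functions to A and to its complement splits the tribe.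

local infixl:65 " ⊹ " => MVAlgebra.oplus
local prefix:max "∼" => MVAlgebra.neg

namespace MVAlgebra

/-! ### Arithmetic of ⊕, ⊖, ⊙ and disjointness. -/

section Arithmetic

variable {M : Type*} [MVAlgebra M]

instance : Std.Associative (oplus : M → M → M) := ⟨oplus_assoc⟩
instance : Std.Commutative (oplus : M → M → M) := ⟨oplus_comm⟩

/-- The truncated difference `a ⊖ b = (a* ⊕ b)*`. -/
def sub (a b : M) : M := ∼(∼a ⊹ b)

/-- The Łukasiewicz product `a ⊙ b = (a* ⊕ b*)*`. -/
def otimes (a b : M) : M := ∼(∼a ⊹ ∼b)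

theorem neg_one : ∼(one : M) = zero := neg_neg _

theorem zero_oplus (a : M) : zero ⊹ a = a := by rw [oplus_comm, oplus_zero]

theorem oplus_one' (a : M) : a ⊹ one = one := oplus_one a

theorem le_iff' {a b : M} : a ≤ b ↔ ∼a ⊹ b = one := le_iff a b

theorem neg_injective {a b : M} (h : ∼a = ∼b) : a = b := by
  rw [← neg_neg a, h, neg_neg]

theorem neg_oplus_self (a : M) : ∼a ⊹ a = one := le_iff'.1 le_rfl

theorem zero_le (a : M) : zero ≤ a := by
  rw [le_iff', oplus_comm]; exact oplus_one a

theorem le_one (a : M) : a ≤ one := by rw [le_iff', oplus_one']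

theorem le_zero {a : M} : a ≤ zero ↔ a = zero :=
  ⟨fun h => le_antisymm h (zero_le a), fun h => h.le⟩

theorem le_oplus_right (a b : M) : a ≤ a ⊹ b := by
  rw [le_iff', ← oplus_assoc, neg_oplus_self, oplus_comm, oplus_one']

theorem le_oplus_left (a b : M) : a ≤ b ⊹ a := oplus_comm a b ▸ le_oplus_right a b

theorem neg_le_neg_iff {a b : M} : ∼a ≤ ∼b ↔ b ≤ a := by
  rw [le_iff', le_iff', neg_neg, oplus_comm]

theorem le_neg_comm {a b : M} : a ≤ ∼b ↔ b ≤ ∼a := by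
  rw [← neg_le_neg_iff, neg_neg]

theorem oplus_sub_comm (a b : M) : a ⊹ sub b a = b ⊹ sub a b := by
  have := luk a b
  rwa [oplus_comm a (∼b), oplus_comm b (∼a)] at this

theorem sub_le_iff {a b c : M} : sub a b ≤ c ↔ a ≤ b ⊹ c := by
  rw [le_iff', le_iff', sub, neg_neg, oplus_assoc]

theorem sub_eq_zero {a b : M} : sub a b = zero ↔ a ≤ b := by
  rw [← le_zero, sub_le_iff, oplus_zero]

theorem oplus_sub_of_le {a b : M} (h : a ≤ b) : a ⊹ sub b a = b := by
  rw [oplus_sub_comm, sub_eq_zero.2 h, oplus_zero]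

theorem oplus_le_oplus_left {b c : M} (h : b ≤ c) (a : M) : a ⊹ b ≤ a ⊹ c := by
  rw [← oplus_sub_of_le h, ← oplus_assoc]; exact le_oplus_right _ _

theorem oplus_le_oplus {a b c d : M} (h : a ≤ b) (h' : c ≤ d) : a ⊹ c ≤ b ⊹ d := by
  refine (oplus_le_oplus_left h' a).trans ?_
  rw [oplus_comm a, oplus_comm b]
  exact oplus_le_oplus_left h d

theorem le_oplus_sub (a b : M) : a ≤ b ⊹ sub a b := sub_le_iff.1 le_rfl

theorem sub_le_sub_right {a b : M} (h : a ≤ b) (c : M) : sub a c ≤ sub b c :=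
  sub_le_iff.2 (h.trans (le_oplus_sub b c))

theorem sub_le_self (a b : M) : sub a b ≤ a := sub_le_iff.2 (le_oplus_left a b)

theorem sub_le_neg (a b : M) : sub a b ≤ ∼b := neg_le_neg_iff.2 (le_oplus_left b _)

theorem oplus_sub_cancel {a b : M} (h : a ≤ ∼b) : sub (a ⊹ b) b = a := by
  apply neg_injective
  have := oplus_sub_of_le (le_neg_comm.1 h)
  rw [sub, neg_neg] at this
  rw [sub, neg_neg, oplus_comm, this]

theorem oplus_right_cancel {a b c : M} (ha : a ≤ ∼c) (hb : b ≤ ∼c) (h : a ⊹ c = b ⊹ c) :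
    a = b := by
  rw [← oplus_sub_cancel ha, h, oplus_sub_cancel hb]

/-- Associativity of the partial sum: if (a + b) + c is defined, so is a + (b + c). -/
theorem le_neg_oplus {a b c : M} (h : a ≤ ∼b) (h' : a ⊹ b ≤ ∼c) : a ≤ ∼(b ⊹ c) := by
  rw [le_neg_comm]
  rw [le_neg_comm] at h h'
  rw [← oplus_sub_of_le h]
  refine oplus_le_oplus_left ?_ b
  rwa [sub, neg_neg]

theorem le_sub_comm {a c j : M} (ha : a ≤ j) (h : c ≤ sub j a) : a ≤ sub j c := by
  rw [sub, le_neg_comm]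
  have h1 : ∼j ≤ ∼a := neg_le_neg_iff.2 ha
  rw [← oplus_sub_of_le h1]
  refine oplus_le_oplus_left ?_ _
  rwa [sub, neg_neg, oplus_comm]

/-- The way suprema are exploited: if j is a least upper bound and j ⊖ c is still an upper bound,
then c vanishes. -/
theorem eq_zero_of_le_sub {c j : M} (hc : c ≤ j) (h : j ≤ sub j c) : c = zero := by
  have h1 : sub j c = j := le_antisymm (sub_le_self j c) h
  have h2 : j ≤ ∼c := h1 ▸ sub_le_neg j c
  have h3 := oplus_sub_of_le hc
  rw [h1] at h3
  exact oplus_right_cancel (le_neg_comm.1 h2) (zero_le _) (h3.trans (zero_oplus j).symm)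

theorem oplus_sub_le {a b j : M} (ha : a ≤ j) (hb : b ≤ j) : a ⊹ sub b a ≤ j := by
  rw [← oplus_sub_of_le ha]
  exact oplus_le_oplus_left (sub_le_sub_right hb a) a

/-- `a ∧ b = 0`. -/
def Perp (a b : M) : Prop := ∀ c, c ≤ a → c ≤ b → c = zero

theorem Perp.symm {a b : M} (h : Perp a b) : Perp b a := fun c h1 h2 => h c h2 h1

theorem Perp.mono {a b a' : M} (h : Perp a b) (ha : a' ≤ a) : Perp a' b :=
  fun c h1 h2 => h c (h1.trans ha) h2

theorem Perp.oplus {a b c : M} (h : Perp a c) (h' : Perp b c) : Perp (a ⊹ b) c := by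
  intro d h1 h2
  exact h d (sub_eq_zero.1 (h' _ (sub_le_iff.2 h1) ((sub_le_self d a).trans h2))) h2

/-- The join of a and b is j = a ⊕ (b ⊖ a), with j ⊖ a = b ⊖ a and j ⊖ b = a ⊖ b. If c lies below
both differences, then j ⊖ c still dominates a and b, hence j, so c = 0. -/
theorem perp_sub_sub (a b : M) : Perp (sub a b) (sub b a) := by
  intro c h1 h2
  have ha : sub (a ⊹ sub b a) a = sub b a := by
    rw [oplus_comm, oplus_sub_cancel (sub_le_neg b a)]
  have hb : sub (a ⊹ sub b a) b = sub a b := by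
    rw [oplus_sub_comm, oplus_comm, oplus_sub_cancel (sub_le_neg a b)]
  have hbj : b ≤ a ⊹ sub b a := le_oplus_sub b a
  refine eq_zero_of_le_sub (j := a ⊹ sub b a) (h2.trans (le_oplus_left _ _)) ?_
  exact oplus_sub_le (le_sub_comm (le_oplus_right _ _) (h2.trans ha.ge))
    (le_sub_comm hbj (h1.trans hb.ge))

theorem oplus_sub_oplus_le (a b c d : M) : sub (a ⊹ c) (b ⊹ d) ≤ sub a b ⊹ sub c d := by
  rw [sub_le_iff]
  refine (oplus_le_oplus (le_oplus_sub a b) (le_oplus_sub c d)).trans (le_of_eq ?_)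
  ac_rfl

theorem sub_le_sub_oplus_sub (a b c : M) : sub a c ≤ sub a b ⊹ sub b c := by
  rw [sub_le_iff]
  calc a ≤ b ⊹ sub a b := le_oplus_sub a b
    _ ≤ (c ⊹ sub b c) ⊹ sub a b := oplus_le_oplus (le_oplus_sub b c) le_rfl
    _ = _ := by ac_rfl

theorem neg_sub_neg (a b : M) : sub (∼a) (∼b) = sub b a := by
  rw [sub, sub, neg_neg, oplus_comm]

theorem one_ne_zero_of_ne {a b : M} (h : a ≠ b) : (one : M) ≠ zero := by
  intro h1
  have : ∀ x : M, x = zero := fun x => le_zero.1 (h1 ▸ le_one x)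
  exact h ((this a).trans (this b).symm)

theorem otimes_eq_zero {a b : M} : otimes a b = zero ↔ a ≤ ∼b := by
  rw [le_iff', otimes]
  constructor
  · intro h; rw [← neg_neg (_ ⊹ _), h]; rfl
  · intro h; rw [h, neg_one]

/-- Halving step for three elements with sum `1`, one of which is at least `1/2`. -/
theorem oplus_self_le_neg {a b : M} (hab : a ≤ ∼b) (h : a ⊹ b ≤ ∼(a ⊹ b)) :
    a ⊹ a ≤ ∼(b ⊹ b) := by
  have h1 : a ≤ ∼(b ⊹ b ⊹ a) := by
    rw [show b ⊹ b ⊹ a = b ⊹ (a ⊹ b) by ac_rfl]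
    exact le_neg_oplus hab h
  have h2 : b ⊹ b ≤ ∼a := by
    rw [le_neg_comm]
    exact h1.trans (neg_le_neg_iff.2 (le_oplus_right _ _))
  rw [le_neg_comm]
  exact le_neg_oplus h2 (le_neg_comm.1 h1)

/-- Halving step for three elements with sum `1`, all of which are at most `1/2`, for the
complements `p`, `q` of two of them. -/
theorem otimes_oplus_otimes_of_le {p q : M} (hp : ∼p ≤ p) (hpq : p ≤ q) :
    otimes p q ⊹ otimes p q = otimes p p ⊹ otimes q q := by
  have hqp : ∼q ≤ ∼p := neg_le_neg_iff.2 hpq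
  have e1 : ∼q ⊹ sub (∼p) (∼q) = ∼p := oplus_sub_of_le hqp
  -- Numerically e = q - p, and 2p - 1, p + q - 1, 2q - 1 is an arithmetic progression with
  -- difference e.
  set e := sub (∼p) (∼q) with he
  have hpp : ∼p ⊹ otimes p p = p := oplus_sub_of_le hp
  have hc : otimes p q = otimes p p ⊹ e := by
    have h1 : ∼q ⊹ otimes p q = p := oplus_sub_of_le (hqp.trans hp)
    have h2 : ∼q ≤ ∼(e ⊹ otimes p p) := by
      refine le_neg_oplus ?_ ?_
      · rw [le_neg_comm]; exact sub_le_neg _ _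
      · rw [e1, le_neg_comm]; exact sub_le_neg p (∼p)
    refine oplus_right_cancel (c := ∼q) (sub_le_neg p (∼q)) ?_ ?_
    · rw [oplus_comm, le_neg_comm]; exact h2
    · rw [oplus_comm, h1]
      calc p = (∼q ⊹ e) ⊹ otimes p p := by rw [e1, hpp]
        _ = _ := by ac_rfl
  have hq : otimes q q = otimes p q ⊹ e := by
    have h1 : ∼p ⊹ otimes p q = q := by
      have := oplus_sub_of_le (hp.trans hpq)
      rwa [sub, oplus_comm (∼q)] at this
    have h2 : ∼q ≤ ∼(e ⊹ otimes p q) := by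
      refine le_neg_oplus ?_ ?_
      · rw [le_neg_comm]; exact sub_le_neg _ _
      · rw [e1, le_neg_comm, otimes, oplus_comm]; exact sub_le_neg q (∼p)
    have h3 : ∼q ⊹ otimes q q = q := oplus_sub_of_le ((hqp.trans hp).trans hpq)
    refine oplus_right_cancel (c := ∼q) (sub_le_neg q (∼q)) ?_ ?_
    · rw [oplus_comm, le_neg_comm]; exact h2
    · rw [oplus_comm, h3]
      calc q = (∼q ⊹ e) ⊹ otimes p q := by rw [e1, h1]
        _ = _ := by ac_rfl
  rw [hq]
  nth_rewrite 1 [hc]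
  ac_rfl

end Arithmetic

/-! ### Binary expansions in MV-chains. -/

section Chain

variable {C : Type*} [MVAlgebra C]

open Classical in
/-- The first binary digit of an element of an MV-chain. -/
noncomputable def digit (a : C) : ℝ := if a ≤ ∼a then 0 else 1

open Classical in
/-- The remainder `2a - digit a` of an element of an MV-chain. -/
noncomputable def shift (a : C) : C := if a ≤ ∼a then a ⊹ a else otimes a a

/-- The real number with the binary expansion of `a`. -/
noncomputable def val (a : C) : ℝ := ∑' n : ℕ, digit (shift^[n] a) * (1 / 2) ^ (n + 1)

theorem digit_nonneg (a : C) : 0 ≤ digit a := by unfold digit; split_ifs <;> norm_num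

theorem digit_le_one (a : C) : digit a ≤ 1 := by unfold digit; split_ifs <;> norm_num

theorem hasSum_half_pow_succ : HasSum (fun n : ℕ => ((1 : ℝ) / 2) ^ (n + 1)) 1 := by
  have := hasSum_geometric_two.mul_left (1 / 2 : ℝ)
  norm_num at this
  simpa [pow_succ, mul_comm] using this

theorem summable_digit (a : C) :
    Summable fun n : ℕ => digit (shift^[n] a) * ((1 : ℝ) / 2) ^ (n + 1) :=
  Summable.of_nonneg_of_le (fun _ => mul_nonneg (digit_nonneg _) (by positivity))
    (fun _ => mul_le_of_le_one_left (by positivity) (digit_le_one _))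
    hasSum_half_pow_succ.summable

theorem val_nonneg (a : C) : 0 ≤ val a :=
  tsum_nonneg fun _ => mul_nonneg (digit_nonneg _) (by positivity)

theorem val_le_one (a : C) : val a ≤ 1 := by
  rw [← hasSum_half_pow_succ.tsum_eq]
  exact (summable_digit a).tsum_le_tsum
    (fun _ => mul_le_of_le_one_left (by positivity) (digit_le_one _))
    hasSum_half_pow_succ.summable

theorem val_eq (a : C) : val a = (digit a + val (shift a)) / 2 := by
  rw [val, (summable_digit a).tsum_eq_zero_add, val, add_div, ← tsum_div_const]
  congr 1
  · simp [div_eq_mul_inv]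
  · refine tsum_congr fun n => ?_
    rw [Function.iterate_succ_apply]
    ring

theorem val_of_le_neg {a : C} (h : a ≤ ∼a) : val a = val (a ⊹ a) / 2 := by
  rw [val_eq, digit, shift, if_pos h, if_pos h, zero_add]

theorem val_of_not_le_neg {a : C} (h : ¬ a ≤ ∼a) : val a = (1 + val (otimes a a)) / 2 := by
  rw [val_eq, digit, shift, if_neg h, if_neg h]

theorem val_one (h : (one : C) ≠ zero) : val (one : C) = 1 := by
  have h1 : ¬ (one : C) ≤ ∼one := by rwa [neg_one, le_zero]
  have h2 := val_of_not_le_neg h1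
  have h3 : otimes (one : C) one = one := by rw [otimes, neg_one, oplus_zero]; rfl
  rw [h3] at h2
  linarith

theorem eq_zero_of_abs_le_half_pow {x c : ℝ} (h : ∀ n : ℕ, |x| ≤ c * (1 / 2) ^ n) : x = 0 := by
  have h1 : Filter.Tendsto (fun n : ℕ => c * (1 / 2 : ℝ) ^ n) Filter.atTop (nhds (c * 0)) :=
    (tendsto_pow_atTop_nhds_zero_of_lt_one (by norm_num) (by norm_num)).const_mul c
  rw [mul_zero] at h1
  exact abs_nonpos_iff.1 (ge_of_tendsto' h1 h)

theorem neg_otimes_self (a : C) : ∼(otimes a a) = ∼a ⊹ ∼a := neg_neg _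

theorem neg_oplus_neg (a b : C) : ∼(a ⊹ b) = otimes (∼a) (∼b) := by
  rw [otimes, neg_neg, neg_neg]

/-- If a > 1/2, the first digits of a and a* are 1 and 0 and their remainders are again
complementary, so the error halves at each digit. The exception is a = a*: both elements have first
digit 0 and remainder 1, hence value 1/2. -/
theorem val_neg (htot : ∀ a b : C, a ≤ b ∨ b ≤ a) (h1 : (one : C) ≠ zero) (a : C) :
    val (∼a) = 1 - val a := by
  suffices h : ∀ n : ℕ, ∀ a : C, |val a + val (∼a) - 1| ≤ 1 * (1 / 2) ^ n by
    linarith [eq_zero_of_abs_le_half_pow fun n => h n a]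
  intro n
  induction n with
  | zero =>
    intro a
    rw [pow_zero, mul_one, abs_le]
    constructor <;> linarith [val_nonneg a, val_nonneg (∼a), val_le_one a, val_le_one (∼a)]
  | succ n ih =>
    have key : ∀ a : C, ¬ a ≤ ∼a → |val a + val (∼a) - 1| ≤ 1 * (1 / 2) ^ (n + 1) := by
      intro a ha
      have h2 : ∼a ≤ ∼(∼a) := by
        rw [neg_neg]; exact (htot _ _).resolve_left ha
      rw [val_of_not_le_neg ha, val_of_le_neg h2, ← neg_otimes_self]
      have := ih (otimes a a)
      rw [show (1 + val (otimes a a)) / 2 + val (∼(otimes a a)) / 2 - 1 =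
        (val (otimes a a) + val (∼(otimes a a)) - 1) * (1 / 2) by ring, abs_mul,
        abs_of_pos (show (0 : ℝ) < 1 / 2 by norm_num), pow_succ]
      nlinarith
    intro a
    by_cases ha : a ≤ ∼a
    · by_cases ha' : ∼a ≤ ∼(∼a)
      · rw [neg_neg] at ha'
        have h2 : ∼a = a := le_antisymm ha' ha
        have h3 : a ⊹ a = one := by
          have := neg_oplus_self a; rwa [h2] at this
        rw [h2, val_of_le_neg ha, h3, val_one h1]
        norm_num
      · have := key _ ha'
        rwa [neg_neg, add_comm (val (∼a))] at this
    · exact key a ha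

/-- Additivity in a form symmetric in three elements with sum 1. If one of them exceeds 1/2, the
three remainders again have sum 1. If none does, the complements of the doubled elements have sum 1,
and the error changes sign. Either way it halves; at the start it is at most 2, as a sum of three
values in [0,1] minus 1. -/
theorem val_add_val_add_val (htot : ∀ a b : C, a ≤ b ∨ b ≤ a) (h1 : (one : C) ≠ zero)
    {a b : C} (hab : a ≤ ∼b) : val a + val b + val (∼(a ⊹ b)) = 1 := by
  suffices h : ∀ n : ℕ, ∀ a b : C, a ≤ ∼b →
      |val a + val b + val (∼(a ⊹ b)) - 1| ≤ 2 * (1 / 2) ^ n by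
    linarith [eq_zero_of_abs_le_half_pow fun n => h n a b hab]
  intro n
  induction n with
  | zero =>
    intro a b _
    rw [pow_zero, mul_one, abs_le]
    constructor <;> linarith [val_nonneg a, val_nonneg b, val_nonneg (∼(a ⊹ b)), val_le_one a,
      val_le_one b, val_le_one (∼(a ⊹ b))]
  | succ n ih =>
    have half : ∀ {x y : ℝ}, x = y / 2 ∨ x = -y / 2 → |y| ≤ 2 * (1 / 2) ^ n →
        |x| ≤ 2 * (1 / 2) ^ (n + 1) := by
      intro x y hx hy
      rw [abs_le] at hy ⊢
      rw [pow_succ]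
      rcases hx with hx | hx <;> constructor <;> linarith [hy.1, hy.2]
    -- one of the three elements, the third, exceeds `1/2`
    have large : ∀ a b : C, a ≤ ∼b → ¬ ∼(a ⊹ b) ≤ ∼∼(a ⊹ b) →
        |val a + val b + val (∼(a ⊹ b)) - 1| ≤ 2 * (1 / 2) ^ (n + 1) := by
      intro a b hab hc
      have hc' : a ⊹ b ≤ ∼(a ⊹ b) := by
        rw [neg_neg] at hc; exact (htot _ _).resolve_right hc
      have ha : a ≤ ∼a := (le_oplus_right a b).trans
        (hc'.trans (neg_le_neg_iff.2 (le_oplus_right a b)))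
      have hb : b ≤ ∼b := (le_oplus_left b a).trans
        (hc'.trans (neg_le_neg_iff.2 (le_oplus_left b a)))
      have := ih _ _ (oplus_self_le_neg hab hc')
      refine half (Or.inl ?_) this
      rw [val_of_le_neg ha, val_of_le_neg hb, val_of_not_le_neg hc]
      have : otimes (∼(a ⊹ b)) (∼(a ⊹ b)) = ∼(a ⊹ a ⊹ (b ⊹ b)) := by
        rw [← neg_oplus_neg]; congr 1; ac_rfl
      rw [this]; ring
    have small : ∀ a b : C, a ≤ ∼b → ∼(a ⊹ b) ≤ ∼∼(a ⊹ b) → a ≤ ∼a → b ≤ ∼b → b ≤ a →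
        |val a + val b + val (∼(a ⊹ b)) - 1| ≤ 2 * (1 / 2) ^ (n + 1) := by
      intro a b hab hc ha hb hba
      have e : ∼(a ⊹ b) ⊹ ∼(a ⊹ b) = ∼(a ⊹ a) ⊹ ∼(b ⊹ b) := by
        simp only [neg_oplus_neg]
        exact otimes_oplus_otimes_of_le (by rwa [neg_neg]) (neg_le_neg_iff.2 hba)
      have hab' : ∼(a ⊹ a) ≤ ∼∼(b ⊹ b) := by
        rw [← otimes_eq_zero] at hc ⊢
        rw [← hc, otimes, otimes, neg_neg, neg_neg, neg_neg]
        congr 1; ac_rfl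
      refine half (Or.inr ?_) (ih _ _ hab')
      rw [val_of_le_neg ha, val_of_le_neg hb, val_of_le_neg hc, e,
        val_neg htot h1 (a ⊹ a), val_neg htot h1 (b ⊹ b), val_neg htot h1 (_ ⊹ _)]
      ring
    intro a b hab
    by_cases hc : ∼(a ⊹ b) ≤ ∼∼(a ⊹ b)
    · have hs : sub (∼b) a = ∼(a ⊹ b) := by rw [sub, neg_neg, oplus_comm]
      have hs' : sub (∼a) b = ∼(a ⊹ b) := by rw [sub, neg_neg]
      by_cases ha : a ≤ ∼a
      · by_cases hb : b ≤ ∼b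
        · rcases htot a b with h | h
          · have := small b a (le_neg_comm.1 hab) (by rwa [oplus_comm]) hb ha h
            rwa [oplus_comm b, add_comm (val b)] at this
          · exact small a b hab hc ha hb h
        -- Here b is the large element; the triple is reordered to make it the third.
        · have e : a ⊹ ∼(a ⊹ b) = ∼b := by
            rw [← hs]; exact oplus_sub_of_le hab
          have := large a (∼(a ⊹ b)) (by rw [neg_neg]; exact le_oplus_right _ _)
            (by rwa [e, neg_neg])
          rw [e, neg_neg] at this
          rwa [add_right_comm]
      · have e : b ⊹ ∼(a ⊹ b) = ∼a := by
          rw [← hs']; exact oplus_sub_of_le (le_neg_comm.1 hab)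
        have := large b (∼(a ⊹ b)) (by rw [neg_neg]; exact le_oplus_left _ _)
          (by rwa [e, neg_neg])
        rw [e, neg_neg] at this
        rwa [add_assoc, add_comm]
    · exact large a b hab hc

theorem val_oplus (htot : ∀ a b : C, a ≤ b ∨ b ≤ a) (h1 : (one : C) ≠ zero) (a b : C) :
    val (a ⊹ b) = min (val a + val b) 1 := by
  have key : ∀ {a b : C}, a ≤ ∼b → val (a ⊹ b) = val a + val b := by
    intro a b h
    have h2 := val_add_val_add_val htot h1 h
    rw [val_neg htot h1] at h2
    linarith
  rcases htot a (∼b) with h | h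
  · rw [key h, min_eq_left]
    rw [← key h]; exact val_le_one _
  · have h2 : a ⊹ b = one := by
      rw [oplus_comm]; rwa [le_iff', neg_neg] at h
    have h3 := oplus_sub_of_le h
    have h4 := key (le_neg_comm.1 (sub_le_neg a (∼b)))
    rw [h3, val_neg htot h1] at h4
    rw [h2, val_one h1, min_eq_right]
    linarith [val_nonneg (sub a (∼b))]

end Chain

/-! ### Prime ideals and homomorphisms to [0,1]. -/

section Ideals

variable {M : Type*} [MVAlgebra M]

/-- Ideals of MV-algebras. -/
structure IsIdeal (J : Set M) : Prop where
  zero_mem : zero ∈ J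
  mem_of_le : ∀ {a b : M}, a ≤ b → b ∈ J → a ∈ J
  oplus_mem : ∀ {a b : M}, a ∈ J → b ∈ J → a ⊹ b ∈ J

/-- This is the ideal generated by J and all elements disjoint from q. -/
theorem IsIdeal.perp {J : Set M} (hJ : IsIdeal J) (q : M) :
    IsIdeal {z : M | ∃ i ∈ J, Perp (sub z i) q} where
  zero_mem := ⟨zero, hJ.zero_mem, fun _ h _ => le_zero.1 (h.trans (sub_le_self _ _))⟩
  mem_of_le := fun h ⟨i, hi, hp⟩ => ⟨i, hi, hp.mono (sub_le_sub_right h i)⟩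
  oplus_mem := fun ⟨i, hi, hp⟩ ⟨j, hj, hq⟩ =>
    ⟨i ⊹ j, hJ.oplus_mem hi hj, (hp.oplus hq).mono (oplus_sub_oplus_le _ _ _ _)⟩

theorem IsIdeal.subset_perp {J : Set M} (q : M) :
    J ⊆ {z : M | ∃ i ∈ J, Perp (sub z i) q} := fun i hi =>
  ⟨i, hi, fun _ h _ => le_zero.1 (h.trans (sub_eq_zero.2 le_rfl).le)⟩

theorem IsIdeal.mem_perp {J : Set M} (hJ : IsIdeal J) {p q : M} (h : Perp p q) :
    p ∈ {z : M | ∃ i ∈ J, Perp (sub z i) q} :=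
  ⟨zero, hJ.zero_mem, h.mono (sub_le_self _ _)⟩

/-- A nonzero element is avoided by some prime ideal. -/
theorem exists_prime_ideal {c : M} (hc : c ≠ zero) :
    ∃ J : Set M, IsIdeal J ∧ c ∉ J ∧ ∀ a b, sub a b ∈ J ∨ sub b a ∈ J := by
  obtain ⟨J, -, hJ⟩ := zorn_subset_nonempty {J : Set M | IsIdeal J ∧ c ∉ J} (by
    intro S hS hchain hne
    refine ⟨⋃₀ S, ⟨⟨?_, ?_, ?_⟩, ?_⟩, fun s hs => Set.subset_sUnion_of_mem hs⟩
    · obtain ⟨J, hJ⟩ := hne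
      exact ⟨J, hJ, (hS hJ).1.zero_mem⟩
    · rintro a b hab ⟨J, hJ, hb⟩
      exact ⟨J, hJ, (hS hJ).1.mem_of_le hab hb⟩
    · rintro a b ⟨J, hJ, ha⟩ ⟨K, hK, hb⟩
      rcases hchain.total hJ hK with h | h
      · exact ⟨K, hK, (hS hK).1.oplus_mem (h ha) hb⟩
      · exact ⟨J, hJ, (hS hJ).1.oplus_mem ha (h hb)⟩
    · rintro ⟨J, hJ, h⟩
      exact (hS hJ).2 h) {zero} ⟨⟨rfl, fun h hb => le_zero.1 (h.trans (le_of_eq hb)), by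
        rintro a b rfl rfl; exact oplus_zero _⟩, hc⟩
  obtain ⟨⟨hI, hcJ⟩, hmax⟩ := hJ
  refine ⟨J, hI, hcJ, fun a b => ?_⟩
  have hp := perp_sub_sub a b
  by_contra! hcon
  -- The ideal generated by J and the elements disjoint from q contains p, so it properly extends J
  -- and by maximality contains c.
  have key : ∀ p q : M, p ∉ J → Perp p q → ∃ i ∈ J, Perp (sub c i) q := by
    intro p q hpJ hpq
    by_contra hno
    exact hpJ (hmax ⟨hI.perp q, hno⟩ (IsIdeal.subset_perp q) (hI.mem_perp hpq))
  obtain ⟨i, hi, h1⟩ := key _ _ hcon.1 hp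
  -- This time the role of q is played by c ⊖ i, so c ⊖ i and c ⊖ j are disjoint; c ⊖ (i ⊕ j) lies
  -- below both, and c ≤ i ⊕ j follows.
  obtain ⟨j, hj, h2⟩ := key _ _ hcon.2 h1.symm
  refine hcJ (hI.mem_of_le (sub_eq_zero.1 (h2 (sub c (i ⊹ j)) ?_ ?_)) (hI.oplus_mem hi hj))
  · rw [sub_le_iff, oplus_assoc]
    exact (le_oplus_sub c j).trans (le_oplus_left _ _)
  · rw [sub_le_iff, oplus_assoc]
    exact (le_oplus_sub c i).trans (oplus_le_oplus_left (le_oplus_left _ _) _)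

/-- The congruence of an ideal. -/
def IsIdeal.setoid {J : Set M} (hJ : IsIdeal J) : Setoid M where
  r a b := sub a b ∈ J ∧ sub b a ∈ J
  iseqv :=
    { refl := fun a => by
        have : sub a a ∈ J := by rw [sub_eq_zero.2 le_rfl]; exact hJ.zero_mem
        exact ⟨this, this⟩
      symm := fun h => ⟨h.2, h.1⟩
      trans := fun h h' =>
        ⟨hJ.mem_of_le (sub_le_sub_oplus_sub _ _ _) (hJ.oplus_mem h.1 h'.1),
          hJ.mem_of_le (sub_le_sub_oplus_sub _ _ _) (hJ.oplus_mem h'.2 h.2)⟩ }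

/-- The quotient of an MV-algebra by an ideal. -/
def IsIdeal.Quot {J : Set M} (hJ : IsIdeal J) : Type _ := Quotient hJ.setoid

/-- The projection to the quotient by an ideal. -/
def IsIdeal.proj {J : Set M} (hJ : IsIdeal J) (a : M) : hJ.Quot := Quotient.mk hJ.setoid a

instance {J : Set M} (hJ : IsIdeal J) : MVAlgebra hJ.Quot :=
  ofAxioms
    (Quotient.map₂ oplus fun _ _ h _ _ h' =>
      ⟨hJ.mem_of_le (oplus_sub_oplus_le _ _ _ _) (hJ.oplus_mem h.1 h'.1),
        hJ.mem_of_le (oplus_sub_oplus_le _ _ _ _) (hJ.oplus_mem h.2 h'.2)⟩)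
    (Quotient.map neg fun a b h => by
      change sub (∼a) (∼b) ∈ J ∧ sub (∼b) (∼a) ∈ J
      rw [neg_sub_neg, neg_sub_neg]
      exact ⟨h.2, h.1⟩)
    (hJ.proj zero)
    (by
      rintro ⟨a⟩ ⟨b⟩ ⟨c⟩
      exact congrArg hJ.proj (oplus_assoc a b c))
    (by
      rintro ⟨a⟩ ⟨b⟩
      exact congrArg hJ.proj (oplus_comm a b))
    (by
      rintro ⟨a⟩
      exact congrArg hJ.proj (oplus_zero a))
    (by
      rintro ⟨a⟩
      exact congrArg hJ.proj (neg_neg a))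
    (by
      rintro ⟨a⟩
      exact congrArg hJ.proj (oplus_one a))
    (by
      rintro ⟨a⟩ ⟨b⟩
      exact congrArg hJ.proj (luk a b))

theorem IsIdeal.proj_eq_zero {J : Set M} (hJ : IsIdeal J) {a : M} :
    hJ.proj a = zero ↔ a ∈ J := by
  change Quotient.mk hJ.setoid a = Quotient.mk hJ.setoid zero ↔ _
  rw [Quotient.eq]
  constructor
  · intro h
    have := h.1
    rwa [sub, oplus_zero, neg_neg] at this
  · intro h
    exact ⟨hJ.mem_of_le (sub_le_self _ _) h, hJ.mem_of_le (sub_le_self _ _) hJ.zero_mem⟩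

theorem IsIdeal.proj_le_proj {J : Set M} (hJ : IsIdeal J) {a b : M} :
    hJ.proj a ≤ hJ.proj b ↔ sub a b ∈ J := by
  rw [← sub_eq_zero, ← hJ.proj_eq_zero]
  rfl

/-- MV-homomorphisms to the standard MV-algebra. -/
structure IsHom (x : M → I) : Prop where
  map_zero : x zero = zero
  map_neg : ∀ a, x (∼a) = ∼(x a)
  map_oplus : ∀ a b, x (a ⊹ b) = x a ⊹ x b

theorem coe_oplus (p q : I) : ((p ⊹ q : I) : ℝ) = min ((p : ℝ) + q) 1 := rfl

theorem coe_neg (p : I) : ((∼p : I) : ℝ) = 1 - p := rfl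

theorem IsHom.coe_oplus {x : M → I} (hx : IsHom x) (a b : M) :
    (x (a ⊹ b) : ℝ) = min ((x a : ℝ) + x b) 1 := by rw [hx.map_oplus]; rfl

theorem IsHom.coe_neg {x : M → I} (hx : IsHom x) (a : M) : (x (∼a) : ℝ) = 1 - x a := by
  rw [hx.map_neg]; rfl

theorem IsHom.coe_zero {x : M → I} (hx : IsHom x) : (x zero : ℝ) = 0 := by
  rw [hx.map_zero]; rfl

theorem IsHom.coe_one {x : M → I} (hx : IsHom x) : (x one : ℝ) = 1 := by
  rw [one, hx.coe_neg, hx.coe_zero, sub_zero]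

theorem IsHom.coe_sub {x : M → I} (hx : IsHom x) (a b : M) :
    (x (sub a b) : ℝ) = max ((x a : ℝ) - x b) 0 := by
  rw [sub, hx.coe_neg, hx.coe_oplus, hx.coe_neg]
  grind

theorem IsHom.coe_otimes {x : M → I} (hx : IsHom x) (a b : M) :
    (x (otimes a b) : ℝ) = max ((x a : ℝ) + x b - 1) 0 := by
  rw [otimes, hx.coe_neg, hx.coe_oplus, hx.coe_neg, hx.coe_neg]
  grind

theorem isHom_val_comp {C : Type*} [MVAlgebra C] (htot : ∀ a b : C, a ≤ b ∨ b ≤ a)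
    (h1 : (one : C) ≠ zero) {g : M → C} (h_zero : g zero = zero) (h_neg : ∀ a, g (∼a) = ∼(g a))
    (h_oplus : ∀ a b, g (a ⊹ b) = g a ⊹ g b) :
    IsHom fun a => (⟨val (g a), val_nonneg _, val_le_one _⟩ : I) where
  map_zero := by
    ext
    change val (g zero) = 0
    have := val_neg htot h1 (one : C)
    rw [h_zero, ← neg_one, this, val_one h1, sub_self]
  map_neg a := by
    ext
    change val (g (∼a)) = 1 - val (g a)
    rw [h_neg, val_neg htot h1]
  map_oplus a b := by
    ext
    change val (g (a ⊹ b)) = min (val (g a) + val (g b)) 1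
    rw [h_oplus, val_oplus htot h1]

/-- A prime ideal avoiding a ⊖ b contains b ⊖ a, so b ≤ a in the quotient chain. The inequality of
values need not be strict, since `val` may kill infinitesimals. -/
theorem exists_isHom_of_not_le {a b : M} (h : ¬ a ≤ b) :
    ∃ x : M → I, IsHom x ∧ (x b : ℝ) ≤ x a := by
  obtain ⟨J, hJ, hab, htot⟩ := exists_prime_ideal (mt sub_eq_zero.1 h)
  have htot' : ∀ p q : hJ.Quot, p ≤ q ∨ q ≤ p := by
    rintro ⟨p⟩ ⟨q⟩
    exact (htot p q).imp hJ.proj_le_proj.2 hJ.proj_le_proj.2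
  have hne : hJ.proj (sub a b) ≠ zero := mt hJ.proj_eq_zero.1 hab
  have hx := isHom_val_comp (M := M) htot' (one_ne_zero_of_ne hne)
    (g := hJ.proj) rfl (fun _ => rfl) (fun _ _ => rfl)
  refine ⟨_, hx, ?_⟩
  have h2 := hx.coe_sub b a
  have h3 : hJ.proj (sub b a) = zero :=
    hJ.proj_eq_zero.2 ((htot a b).resolve_left hab)
  have h4 : val (hJ.proj (sub b a)) = 0 := by
    rw [h3]; exact hx.coe_zero
  change val (hJ.proj (sub b a)) = _ at h2
  rw [h4] at h2
  exact sub_nonpos.1 ((le_max_left _ _).trans h2.ge)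

/-- The multiple `a ⊕ ⋯ ⊕ a`. -/
def nmul (a : M) : ℕ → M
  | 0 => zero
  | n + 1 => nmul a n ⊹ a

/-- If every homomorphism kills a, it kills all multiples na, which forces na ≤ a*; so na = (n+1)a ⊖
a. With b the supremum of the multiples, b ⊖ a is then an upper bound too, and a = 0. -/
theorem exists_isHom_ne_zero (hM : IsSigmaComplete M) {a : M} (ha : a ≠ zero) :
    ∃ x : M → I, IsHom x ∧ (x a : ℝ) ≠ 0 := by
  by_contra! hcon
  have h0 : ∀ x : M → I, IsHom x → ∀ n, (x (nmul a n) : ℝ) = 0 := by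
    intro x hx n
    induction n with
    | zero => exact hx.coe_zero
    | succ n ih => rw [nmul, hx.coe_oplus, ih, hcon x hx]; norm_num
  have hle : ∀ n, nmul a n ≤ ∼a := by
    intro n
    by_contra hn
    obtain ⟨x, hx, hxa⟩ := exists_isHom_of_not_le hn
    rw [hx.coe_neg, hcon x hx, h0 x hx] at hxa
    norm_num at hxa
  obtain ⟨b, hb⟩ := (hM (nmul a)).1
  have hab : a ≤ b := by
    have := hb.1 ⟨1, rfl⟩
    rwa [nmul, nmul, zero_oplus] at this
  refine ha (eq_zero_of_le_sub hab (hb.2 ?_))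
  rintro _ ⟨n, rfl⟩
  rw [← oplus_sub_cancel (hle n)]
  exact sub_le_sub_right (hb.1 ⟨n + 1, rfl⟩) a

theorem le_of_forall_isHom (hM : IsSigmaComplete M) {a b : M}
    (h : ∀ x : M → I, IsHom x → (x a : ℝ) ≤ x b) : a ≤ b := by
  rw [← sub_eq_zero]
  by_contra hne
  obtain ⟨x, hx, hx0⟩ := exists_isHom_ne_zero hM hne
  rw [hx.coe_sub] at hx0
  exact hx0 (max_eq_right (by linarith [h x hx]))

theorem IsHom.mono {x : M → I} (hx : IsHom x) {a b : M} (h : a ≤ b) : (x a : ℝ) ≤ x b := by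
  have := hx.coe_sub a b
  rw [sub_eq_zero.2 h, hx.coe_zero] at this
  linarith [le_max_left ((x a : ℝ) - x b) 0]

end Ideals

/-! ### The spectrum and pointwise suprema off meagre sets. -/

section Spectrum

variable {M : Type*} [MVAlgebra M]

variable (M) in
/-- The space of homomorphisms to the standard MV-algebra, with the topology of pointwise
convergence. -/
abbrev Spec : Type _ := {x : M → I // IsHom x}

theorem isHom_iff {x : M → I} : IsHom x ↔ (x zero : ℝ) = 0 ∧ (∀ a, (x (∼a) : ℝ) = 1 - x a) ∧
    ∀ a b, (x (a ⊹ b) : ℝ) = min ((x a : ℝ) + x b) 1 :=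
  ⟨fun h => ⟨h.coe_zero, h.coe_neg, h.coe_oplus⟩, fun h =>
    ⟨Subtype.ext h.1, fun a => Subtype.ext (h.2.1 a), fun a b => Subtype.ext (h.2.2 a b)⟩⟩

theorem isClosed_isHom : IsClosed {x : M → I | IsHom x} := by
  have hc : ∀ a : M, Continuous fun x : M → I => (x a : ℝ) := fun a =>
    continuous_subtype_val.comp (continuous_apply a)
  simp only [isHom_iff, Set.ofPred_and, Set.ofPred_forall]
  refine (isClosed_eq (hc _) continuous_const).inter
    ((isClosed_iInter fun a => ?_).inter (isClosed_iInter fun a => isClosed_iInter fun b => ?_))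
  · exact isClosed_eq (hc _) (continuous_const.sub (hc _))
  · exact isClosed_eq (hc _) (((hc _).add (hc _)).min continuous_const)

instance : CompactSpace (Spec M) := isCompact_iff_compactSpace.1 isClosed_isHom.isCompact

theorem continuous_eval (a : M) : Continuous fun x : Spec M => (x.1 a : ℝ) :=
  continuous_subtype_val.comp ((continuous_apply a).comp continuous_subtype_val)

theorem IsHom.coe_nmul {x : M → I} (hx : IsHom x) (a : M) (n : ℕ) :
    (x (nmul a n) : ℝ) = min (n * (x a : ℝ)) 1 := by
  have h0 := (x a).2.1
  induction n with
  | zero => rw [nmul, hx.coe_zero]; norm_num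
  | succ n ih =>
    rw [nmul, hx.coe_oplus, ih]
    push_cast
    have : 0 ≤ n * (x a : ℝ) := by positivity
    rw [add_one_mul]
    grind

theorem IsHom.exists_eq_one_of_ne_zero {x y : M → I} (hx : IsHom x) (hy : IsHom y) {a : M}
    (hxa : 0 < (x a : ℝ)) (hya : (y a : ℝ) = 0) : ∃ c, (x c : ℝ) = 1 ∧ (y c : ℝ) = 0 := by
  obtain ⟨n, hn⟩ := exists_nat_ge (1 / (x a : ℝ))
  refine ⟨nmul a n, ?_, ?_⟩
  · rw [hx.coe_nmul, min_eq_right]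
    rwa [div_le_iff₀ hxa] at hn
  · rw [hy.coe_nmul, hya]; norm_num

/-- While both values lie on the same side of 1/2, replacing a by a ⊕ a or a ⊙ a doubles their gap.
Once 1/2 separates them, a ⊙ a is positive at x and zero at y, and a multiple of it does the job. -/
theorem IsHom.exists_separating_of_lt {x y : M → I} (hx : IsHom x) (hy : IsHom y) {a : M}
    (h : (y a : ℝ) < x a) : ∃ c, (x c : ℝ) = 1 ∧ (y c : ℝ) = 0 := by
  suffices key : ∀ n : ℕ, ∀ a : M, (1 / 2 : ℝ) ^ n ≤ x a - y a →
      ∃ c, (x c : ℝ) = 1 ∧ (y c : ℝ) = 0 by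
    obtain ⟨n, hn⟩ := exists_pow_lt_of_lt_one (sub_pos.2 h) (show (1 / 2 : ℝ) < 1 by norm_num)
    exact key n a hn.le
  intro n
  induction n with
  | zero =>
    intro a ha
    refine ⟨a, ?_, ?_⟩ <;> linarith [(x a).2.1, (x a).2.2, (y a).2.1, (y a).2.2]
  | succ n ih =>
    intro a ha
    rw [pow_succ] at ha
    have hpos : (0 : ℝ) < (1 / 2) ^ n := by positivity
    rcases le_or_gt (x a : ℝ) (1 / 2) with h1 | h1
    · refine ih (a ⊹ a) ?_
      rw [hx.coe_oplus, hy.coe_oplus, min_eq_left (by linarith), min_eq_left (by linarith)]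
      linarith
    · rcases le_or_gt (1 / 2) (y a : ℝ) with h2 | h2
      · refine ih (otimes a a) ?_
        rw [hx.coe_otimes, hy.coe_otimes, max_eq_left (by linarith), max_eq_left (by linarith)]
        linarith
      · refine hx.exists_eq_one_of_ne_zero hy (a := otimes a a) ?_ ?_
        · rw [hx.coe_otimes]; exact lt_max_of_lt_left (by linarith)
        · rw [hy.coe_otimes]; exact max_eq_right (by linarith)

theorem IsHom.exists_separating {x y : M → I} (hx : IsHom x) (hy : IsHom y) (h : x ≠ y) :
    ∃ c, (x c : ℝ) = 1 ∧ (y c : ℝ) = 0 := by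
  obtain ⟨a, ha⟩ := Function.ne_iff.1 h
  have ha' : (x a : ℝ) ≠ y a := fun h => ha (Subtype.ext h)
  rcases ha'.lt_or_gt with h1 | h1
  · refine hx.exists_separating_of_lt hy (a := ∼a) ?_
    rw [hx.coe_neg, hy.coe_neg]; linarith
  · exact hx.exists_separating_of_lt hy h1

/-- Elements of `M` separate points of its spectrum from closed sets. -/
theorem exists_eq_one_and_eq_zero_off {U : Set (Spec M)} (hU : IsOpen U) {x : Spec M}
    (hx : x ∈ U) : ∃ c : M, (x.1 c : ℝ) = 1 ∧ ∀ y ∉ U, (y.1 c : ℝ) = 0 := by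
  refine hU.isClosed_compl.isCompact.induction_on
    (p := fun S => ∃ c : M, (x.1 c : ℝ) = 1 ∧ ∀ y ∈ S, (y.1 c : ℝ) = 0) ?_ ?_ ?_ ?_
  · exact ⟨one, x.2.coe_one, by simp⟩
  · rintro S S' hS ⟨c, h1, h2⟩
    exact ⟨c, h1, fun y hy => h2 y (hS hy)⟩
  · rintro S S' ⟨c, h1, h2⟩ ⟨d, h3, h4⟩
    refine ⟨otimes c d, ?_, ?_⟩
    · rw [x.2.coe_otimes, h1, h3]; norm_num
    · intro y hy
      rw [y.2.coe_otimes]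
      refine max_eq_right ?_
      rcases hy with hy | hy
      · rw [h2 y hy]; linarith [(y.1 d).2.2]
      · rw [h4 y hy]; linarith [(y.1 c).2.2]
  · intro y hy
    have hxy : x.1 ≠ y.1 := fun h => hy (Subtype.ext h ▸ hx)
    obtain ⟨c, h1, h2⟩ := x.2.exists_separating y.2 hxy
    -- Squaring makes c vanish on a whole neighbourhood of y while keeping the value 1 at x.
    refine ⟨{z : Spec M | (z.1 c : ℝ) < 1 / 2}, mem_nhdsWithin_of_mem_nhds
      ((isOpen_lt (continuous_eval c) continuous_const).mem_nhds ?_), otimes c c, ?_, ?_⟩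
    · change (y.1 c : ℝ) < 1 / 2
      rw [h2]; norm_num
    · rw [x.2.coe_otimes, h1]; norm_num
    · intro z hz
      rw [z.2.coe_otimes]
      have : (z.1 c : ℝ) < 1 / 2 := hz
      exact max_eq_right (by linarith)

/-- Where c is nonzero, every gap b - aₙ is at least δ. Induction on k with c ≤ kδ: subtracting b ⊖
aₙ from c lowers the bound by δ, so c ⊖ (b ⊖ aₙ) = 0 and c ≤ b ⊖ aₙ for all n. Then b ⊖ c is an
upper bound, whence c = 0. -/
theorem eq_zero_of_isLUB (hM : IsSigmaComplete M) {a : ℕ → M} {b c : M}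
    (hb : IsLUB (Set.range a) b) {δ : ℝ} (hδ : 0 < δ)
    (hc : ∀ x : M → I, IsHom x → (x c : ℝ) ≠ 0 → ∀ n, δ ≤ x b - x (a n)) : c = zero := by
  suffices key : ∀ k : ℕ, ∀ c : M,
      (∀ x : M → I, IsHom x → (x c : ℝ) ≠ 0 → ∀ n, δ ≤ x b - x (a n)) →
      (∀ x : M → I, IsHom x → (x c : ℝ) ≤ k * δ) → c = zero by
    obtain ⟨k, hk⟩ := exists_nat_ge (1 / δ)
    rw [div_le_iff₀ hδ] at hk
    exact key k c hc fun x _ => (x c).2.2.trans hk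
  intro k
  induction k with
  | zero =>
    intro c _ h
    refine le_zero.1 (le_of_forall_isHom hM fun x hx => ?_)
    rw [hx.coe_zero]
    simpa using h x hx
  | succ k ih =>
    intro c hc hk
    have hle : ∀ n (x : M → I), IsHom x → (x (a n) : ℝ) ≤ x b := fun n x hx =>
      hx.mono (hb.1 ⟨n, rfl⟩)
    have h1 : ∀ n, c ≤ sub b (a n) := by
      intro n
      rw [← sub_eq_zero]
      refine ih _ ?_ ?_
      · intro x hx h0
        refine hc x hx fun h => h0 ?_
        rw [hx.coe_sub, h]
        exact max_eq_right (by linarith [(x (sub b (a n))).2.1])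
      · intro x hx
        rw [hx.coe_sub, hx.coe_sub]
        have hkδ : 0 ≤ k * δ := by positivity
        have h3 := hk x hx
        push_cast at h3
        refine max_le ?_ hkδ
        by_cases h0 : (x c : ℝ) = 0
        · linarith [le_max_right ((x b : ℝ) - x (a n)) 0]
        · linarith [le_max_left ((x b : ℝ) - x (a n)) 0, hc x hx h0 n]
    refine eq_zero_of_le_sub ((h1 0).trans (sub_le_self _ _)) (hb.2 ?_)
    rintro _ ⟨n, rfl⟩
    exact le_sub_comm (hb.1 ⟨n, rfl⟩) (h1 n)

/-- Countable suprema of `M` are computed pointwise off a meagre subset of its spectrum. -/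
theorem eventually_isLUB (hM : IsSigmaComplete M) {a : ℕ → M} {b : M}
    (hb : IsLUB (Set.range a) b) :
    ∀ᶠ x : Spec M in residual (Spec M), IsLUB (Set.range fun n => x.1 (a n)) (x.1 b) := by
  have key : ∀ k : ℕ, ∀ᶠ x : Spec M in residual (Spec M),
      ∃ n, (x.1 b : ℝ) - x.1 (a n) < 1 / ((k : ℝ) + 1) := by
    intro k
    refine residual_of_dense_open ?_ ?_
    · simp only [Set.ofPred_exists]
      exact isOpen_iUnion fun n =>
        isOpen_lt ((continuous_eval b).sub (continuous_eval (a n))) continuous_const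
    · rw [dense_iff_inter_open]
      rintro U hU ⟨x, hx⟩
      by_contra hempty
      -- If every gap were at least 1/(k+1) throughout U, an element supported in U would vanish,
      -- although it takes the value 1 at x.
      obtain ⟨c, hc1, hc0⟩ := exists_eq_one_and_eq_zero_off hU hx
      have hc : c = zero := by
        refine eq_zero_of_isLUB hM hb (δ := 1 / ((k : ℝ) + 1)) (by positivity) ?_
        intro y hy hyc n
        by_contra hlt
        have hyU : (⟨y, hy⟩ : Spec M) ∈ U := by
          by_contra hyU; exact hyc (hc0 _ hyU)
        exact hempty ⟨⟨y, hy⟩, hyU, n, not_le.1 hlt⟩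
      rw [hc, x.2.coe_zero] at hc1
      norm_num at hc1
  filter_upwards [eventually_countable_forall.2 key] with x hx
  refine ⟨?_, ?_⟩
  · rintro _ ⟨n, rfl⟩
    exact Subtype.coe_le_coe.1 (x.2.mono (hb.1 ⟨n, rfl⟩))
  · intro u hu
    refine Subtype.coe_le_coe.1 (le_of_forall_pos_lt_add fun ε hε => ?_)
    obtain ⟨k, hk⟩ := exists_nat_one_div_lt hε
    obtain ⟨n, hn⟩ := hx k
    have : (x.1 (a n) : ℝ) ≤ u := Subtype.coe_le_coe.2 (hu ⟨n, rfl⟩)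
    linarith

/-- By Baire's theorem the set where the two evaluations agree is dense; being closed, it is the
whole spectrum, and homomorphisms separate elements. -/
theorem eq_of_eventually_eq (hM : IsSigmaComplete M) {a b : M}
    (h : ∀ᶠ x : Spec M in residual (Spec M), x.1 a = x.1 b) : a = b := by
  have h1 : Dense {x : Spec M | (x.1 a : ℝ) = x.1 b} :=
    dense_of_mem_residual (Filter.mem_of_superset h fun x hx => congrArg Subtype.val hx)
  have h2 : IsClosed {x : Spec M | (x.1 a : ℝ) = x.1 b} :=
    isClosed_eq (continuous_eval a) (continuous_eval b)
  have h3 : ∀ x : Spec M, (x.1 a : ℝ) = x.1 b := fun x => by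
    have : x ∈ {x : Spec M | (x.1 a : ℝ) = x.1 b} := h2.closure_eq ▸ h1 x
    exact this
  exact le_antisymm (le_of_forall_isHom hM fun x hx => (h3 ⟨x, hx⟩).le)
    (le_of_forall_isHom hM fun x hx => (h3 ⟨x, hx⟩).ge)

end Spectrum

/-! ### The tribe on the spectrum and its projection onto `M`. -/

section LoomisSikorski

/-- The sums `p 0 ⊕ ⋯ ⊕ p (n - 1)`. -/
def psum {M : Type*} [MVAlgebra M] (p : ℕ → M) : ℕ → M
  | 0 => zero
  | n + 1 => psum p n ⊹ p n

theorem coe_psum (p : ℕ → I) (n : ℕ) :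
    ((psum p n : I) : ℝ) = min (∑ i ∈ Finset.range n, (p i : ℝ)) 1 := by
  induction n with
  | zero => simp [psum]; rfl
  | succ n ih =>
    rw [psum, coe_oplus, ih, Finset.sum_range_succ]
    have := (p n).2.1
    grind

theorem isLUB_truncSum (p : ℕ → I) : IsLUB (Set.range (psum p)) (truncSum p) := by
  have hsum : ∀ n, ENNReal.ofReal (∑ i ∈ Finset.range n, (p i : ℝ)) =
      ∑ i ∈ Finset.range n, ENNReal.ofReal (p i : ℝ) := fun n =>
    ENNReal.ofReal_sum_of_nonneg fun i _ => (p i).2.1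
  constructor
  · rintro _ ⟨n, rfl⟩
    rw [← Subtype.coe_le_coe, coe_psum]
    change _ ≤ (min (∑' n, ENNReal.ofReal (p n)) 1).toReal
    rw [← ENNReal.ofReal_le_iff_le_toReal (by simp), ENNReal.ofReal_min, ENNReal.ofReal_one, hsum]
    exact min_le_min_right _ (ENNReal.sum_le_tsum _)
  · intro u hu
    rw [← Subtype.coe_le_coe]
    change (min (∑' n, ENNReal.ofReal (p n)) 1).toReal ≤ _
    refine ENNReal.toReal_le_of_le_ofReal u.2.1 ?_
    rcases u.2.2.eq_or_lt with h1 | h1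
    · rw [h1, ENNReal.ofReal_one]; exact min_le_right _ _
    · refine (min_le_left _ _).trans ?_
      rw [ENNReal.tsum_eq_iSup_nat]
      refine iSup_le fun n => ?_
      rw [← hsum]
      refine ENNReal.ofReal_le_ofReal ?_
      have h2 : ((psum p n : I) : ℝ) ≤ u := Subtype.coe_le_coe.2 (hu ⟨n, rfl⟩)
      rw [coe_psum] at h2
      exact (min_le_iff.1 h2).resolve_right (not_le.2 h1)

variable {M : Type*} [MVAlgebra M]

theorem IsHom.map_psum {x : M → I} (hx : IsHom x) (a : ℕ → M) (n : ℕ) :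
    x (psum a n) = psum (fun i => x (a i)) n := by
  induction n with
  | zero => exact hx.map_zero
  | succ n ih => rw [psum, hx.map_oplus, ih, psum]

/-- The tribe of functions on the spectrum that agree with an element of `M` off a meagre set. -/
def specTribe (hM : IsSigmaComplete M) : Tribe (Spec M) where
  carrier := {f | ∃ a : M, ∀ᶠ x : Spec M in residual (Spec M), f x = x.1 a}
  one_mem := ⟨one, Filter.Eventually.of_forall fun x => Subtype.ext x.2.coe_one.symm⟩
  symm_mem := by
    rintro f ⟨a, ha⟩
    refine ⟨∼a, ?_⟩
    filter_upwards [ha] with x hx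
    rw [hx, x.2.map_neg]; rfl
  truncSum_mem := by
    intro f hf
    choose a ha using hf
    -- The truncated infinite sum is the supremum of the finite truncated sums, so it agrees with
    -- their supremum b in `M` off countably many meagre sets.
    obtain ⟨b, hb⟩ := (hM (psum a)).1
    refine ⟨b, ?_⟩
    filter_upwards [eventually_countable_forall.2 ha, eventually_isLUB hM hb] with x hx hxb
    have h1 := isLUB_truncSum fun n => f n x
    refine h1.unique ?_
    have : psum (fun n => f n x) = fun n => x.1 (psum a n) := by
      funext n
      rw [x.2.map_psum]
      simp only [hx]
    rwa [this]

/-- The element of `M` with which a function of the tribe agrees off a meagre set. -/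
noncomputable def specHom (hM : IsSigmaComplete M) (f : (specTribe hM).carrier) : M :=
  Classical.choose f.2

theorem specHom_spec (hM : IsSigmaComplete M) (f : (specTribe hM).carrier) :
    ∀ᶠ x : Spec M in residual (Spec M), f.1 x = x.1 (specHom hM f) :=
  Classical.choose_spec f.2

theorem specHom_eq (hM : IsSigmaComplete M) {f : (specTribe hM).carrier} {a : M}
    (h : ∀ᶠ x : Spec M in residual (Spec M), f.1 x = x.1 a) : specHom hM f = a := by
  refine eq_of_eventually_eq hM ?_
  filter_upwards [h, specHom_spec hM f] with x h1 h2
  rw [← h1, ← h2]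

theorem specHom_surjective (hM : IsSigmaComplete M) : Function.Surjective (specHom hM) := by
  intro a
  have h : ∀ᶠ x : Spec M in residual (Spec M), x.1 a = x.1 a := Filter.Eventually.of_forall
    fun _ => rfl
  exact ⟨⟨fun x => x.1 a, a, h⟩, specHom_eq hM h⟩

theorem isSigmaHom_specHom (hM : IsSigmaComplete M) : IsSigmaHom (specHom hM) where
  map_zero := specHom_eq hM (Filter.Eventually.of_forall fun x => x.2.map_zero.symm)
  map_neg f := by
    refine specHom_eq hM ?_
    filter_upwards [specHom_spec hM f] with x hx
    rw [x.2.map_neg, ← hx]; rfl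
  map_oplus f g := by
    refine specHom_eq hM ?_
    filter_upwards [specHom_spec hM f, specHom_spec hM g] with x hx hx'
    rw [x.2.map_oplus, ← hx, ← hx']; rfl
  map_sup f g hg := by
    obtain ⟨b, hb⟩ := (hM fun n => specHom hM (f n)).1
    have h1 : ∀ᶠ x : Spec M in residual (Spec M), (⨆ n, (f n).1 x) = x.1 b := by
      filter_upwards [eventually_countable_forall.2 fun n => specHom_spec hM (f n),
        eventually_isLUB hM hb] with x hx hxb
      simp only [hx]
      exact isLUB_iSup.unique hxb
    -- The pointwise supremum agrees with b off a meagre set, so it belongs to the tribe and is the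
    -- supremum there.
    have h2 : g = ⟨fun x => ⨆ n, (f n).1 x, b, h1⟩ := by
      refine hg.unique ⟨?_, ?_⟩
      · rintro _ ⟨n, rfl⟩ x
        exact le_iSup (fun n => (f n).1 x) n
      · intro u hu x
        exact iSup_le fun n => hu ⟨n, rfl⟩ x
    rw [h2, specHom_eq hM h1]
    exact hb

end LoomisSikorski

/-! ### States, their pullbacks, and truncated sums. -/

section States

variable {M N : Type*} [MVAlgebra M] [MVAlgebra N]

theorem IsState.map_zero {s : M → ℝ} (hs : IsState s) : s zero = 0 := by
  have := hs.map_sum zero zero zero ⟨zero_le _, oplus_zero _⟩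
  linarith

theorem IsState.mono {s : M → ℝ} (hs : IsState s) {a b : M} (h : a ≤ b) : s a ≤ s b := by
  have := hs.map_sum a (sub b a) b
    ⟨le_neg_comm.1 (sub_le_neg b a), oplus_sub_of_le h⟩
  linarith [(hs.mem_Icc (sub b a)).1]

theorem IsSigmaHom.map_one {h : M → N} (hh : IsSigmaHom h) : h one = one := by
  rw [one, hh.map_neg, hh.map_zero, one]

theorem IsSigmaHom.mono {h : M → N} (hh : IsSigmaHom h) {a b : M} (hab : a ≤ b) :
    h a ≤ h b := by
  rw [le_iff'] at hab ⊢
  rw [← hh.map_neg, ← hh.map_oplus, hab, hh.map_one]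

theorem IsSigmaAdditiveState.comp {s : N → ℝ} (hs : IsSigmaAdditiveState s) {h : M → N}
    (hh : IsSigmaHom h) : IsSigmaAdditiveState fun a => s (h a) where
  mem_Icc a := hs.mem_Icc _
  map_one := by rw [hh.map_one, hs.map_one]
  map_sum a b c hc := hs.map_sum _ _ _
    ⟨by rw [← hh.map_neg]; exact hh.mono hc.1, by rw [← hh.map_oplus, hc.2]⟩
  tendsto a b ha hb := hs.tendsto _ _ (fun _ _ hmn => hh.mono (ha hmn)) (hh.map_sup a b hb)

theorem coe_otimes (p q : I) : ((otimes p q : I) : ℝ) = max ((p : ℝ) + q - 1) 0 := by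
  rw [otimes, coe_neg, coe_oplus, coe_neg, coe_neg]
  grind

theorem coe_sub (p q : I) : ((sub p q : I) : ℝ) = max ((p : ℝ) - q) 0 := by
  rw [sub, coe_neg, coe_oplus, coe_neg]
  grind

theorem le_truncSum (p : ℕ → I) (n : ℕ) : p n ≤ truncSum p :=
  (le_oplus_left (p n) (psum p n)).trans ((isLUB_truncSum p).1 ⟨n + 1, rfl⟩)

theorem truncSum_eq_zero {p : ℕ → I} (h : ∀ n, p n = 0) : truncSum p = 0 := by
  apply Subtype.ext
  change (min (∑' n, ENNReal.ofReal (p n)) 1).toReal = 0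
  simp [h]

theorem truncSum_const_of_pos {p : I} (h : 0 < (p : ℝ)) : truncSum (fun _ => p) = 1 := by
  apply Subtype.ext
  change (min (∑' _, ENNReal.ofReal p) 1).toReal = 1
  rw [ENNReal.tsum_const_eq_top_of_ne_zero (by simpa using h)]
  simp

end States

end MVAlgebra

namespace Tribe

open MVAlgebra

variable {X : Type*} (T : Tribe X)

/-! ### Pointwise calculus in a tribe. -/

section Pointwise

variable {T}

theorem coe_oplus (f g : T.carrier) (x : X) :
    ((f ⊹ g).1 x : ℝ) = min ((f.1 x : ℝ) + g.1 x) 1 := rfl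

theorem coe_neg (f : T.carrier) (x : X) : ((∼f).1 x : ℝ) = 1 - f.1 x := rfl

theorem coe_zero (x : X) : ((zero : T.carrier).1 x : ℝ) = 0 := rfl

theorem coe_one (x : X) : ((one : T.carrier).1 x : ℝ) = 1 := by
  rw [one, coe_neg, coe_zero, sub_zero]

theorem coe_otimes (f g : T.carrier) (x : X) :
    ((otimes f g).1 x : ℝ) = max ((f.1 x : ℝ) + g.1 x - 1) 0 :=
  MVAlgebra.coe_otimes (f.1 x) (g.1 x)

theorem coe_sub (f g : T.carrier) (x : X) :
    ((sub f g).1 x : ℝ) = max ((f.1 x : ℝ) - g.1 x) 0 :=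
  MVAlgebra.coe_sub (f.1 x) (g.1 x)

theorem le_iff_coe {f g : T.carrier} : f ≤ g ↔ ∀ x, (f.1 x : ℝ) ≤ g.1 x := Iff.rfl

theorem ext_coe {f g : T.carrier} (h : ∀ x, (f.1 x : ℝ) = g.1 x) : f = g :=
  Subtype.ext (funext fun x => Subtype.ext (h x))

theorem isSum_iff {f g k : T.carrier} :
    IsSum f g k ↔ ∀ x, (f.1 x : ℝ) + g.1 x = k.1 x := by
  constructor
  · rintro ⟨h1, h2⟩ x
    have h3 := le_iff_coe.1 h1 x
    rw [coe_neg] at h3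
    rw [← h2, coe_oplus, min_eq_left (by linarith)]
  · intro h
    refine ⟨le_iff_coe.2 fun x => ?_, ext_coe fun x => ?_⟩
    · rw [coe_neg]; linarith [h x, (k.1 x).2.2]
    · rw [coe_oplus, h, min_eq_left (k.1 x).2.2]

theorem psum_apply (f : ℕ → T.carrier) (n : ℕ) (x : X) :
    (psum f n).1 x = psum (fun i => (f i).1 x) n := by
  induction n with
  | zero => rfl
  | succ n ih =>
    rw [psum, psum, ← ih]; rfl

theorem isLUB_psum {f : ℕ → T.carrier} {g : T.carrier}
    (h : ∀ x, g.1 x = truncSum fun n => (f n).1 x) : IsLUB (Set.range (psum f)) g := by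
  constructor
  · rintro _ ⟨n, rfl⟩ x
    rw [h, psum_apply]
    exact (isLUB_truncSum _).1 ⟨n, rfl⟩
  · intro u hu x
    rw [h]
    refine (isLUB_truncSum _).2 ?_
    rintro _ ⟨n, rfl⟩
    rw [← psum_apply]
    exact hu ⟨n, rfl⟩ x

end Pointwise

/-! ### Characteristic functions, measurability and central elements. -/

section Chi

theorem chi_of_mem {A : Set X} {x : X} (h : x ∈ A) : chi A x = 1 := Set.indicator_of_mem h _

theorem chi_of_notMem {A : Set X} {x : X} (h : x ∉ A) : chi A x = 0 :=
  Set.indicator_of_notMem h _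

theorem chi_iUnion (A : ℕ → Set X) :
    chi (⋃ n, A n) = fun x => truncSum fun n => chi (A n) x := by
  funext x
  by_cases h : x ∈ ⋃ n, A n
  · rw [chi_of_mem h]
    obtain ⟨n, hn⟩ := Set.mem_iUnion.1 h
    refine le_antisymm ?_ unitInterval.le_one'
    have := le_truncSum (fun n => chi (A n) x) n
    rwa [chi_of_mem hn] at this
  · rw [chi_of_notMem h, truncSum_eq_zero]
    exact fun n => chi_of_notMem fun hn => h (Set.mem_iUnion.2 ⟨n, hn⟩)

/-- The σ-algebra of sets whose characteristic function belongs to the tribe. -/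
abbrev measurableSpace : MeasurableSpace X where
  MeasurableSet' A := chi A ∈ T.carrier
  measurableSet_empty := by
    convert T.zero_mem using 1
    exact Set.indicator_empty _
  measurableSet_compl A hA := by
    convert T.symm_mem _ hA using 1
    funext x
    by_cases h : x ∈ A
    · rw [chi_of_mem h, chi_of_notMem (show x ∉ Aᶜ from fun h' => h' h), unitInterval.symm_one]
    · rw [chi_of_notMem h, chi_of_mem (show x ∈ Aᶜ from h), unitInterval.symm_zero]
  measurableSet_iUnion A hA := by
    rw [chi_iUnion]
    exact T.truncSum_mem _ hA

variable {T}

/-- The characteristic function of a measurable set as an element of the tribe. -/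
noncomputable def ind {A : Set X} (hA : MeasurableSet[T.measurableSpace] A) : T.carrier :=
  ⟨chi A, hA⟩

theorem ind_of_mem {A : Set X} (hA : MeasurableSet[T.measurableSpace] A) {x : X} (h : x ∈ A) :
    ((ind hA).1 x : ℝ) = 1 := congrArg Subtype.val (chi_of_mem h)

theorem ind_of_notMem {A : Set X} (hA : MeasurableSet[T.measurableSpace] A) {x : X}
    (h : x ∉ A) : ((ind hA).1 x : ℝ) = 0 := congrArg Subtype.val (chi_of_notMem h)

/-- The truncated sum of infinitely many copies of f is the characteristic function of {f > 0}. -/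
theorem measurableSet_pos (f : T.carrier) :
    MeasurableSet[T.measurableSpace] {x | 0 < (f.1 x : ℝ)} := by
  change chi _ ∈ T.carrier
  convert T.truncSum_mem (fun _ => f.1) (fun _ => f.2) using 1
  funext x
  by_cases h : 0 < (f.1 x : ℝ)
  · rw [chi_of_mem (show x ∈ {x | 0 < (f.1 x : ℝ)} from h), truncSum_const_of_pos h]
  · rw [chi_of_notMem (show x ∉ {x | 0 < (f.1 x : ℝ)} from h), truncSum_eq_zero]
    exact fun _ => le_antisymm (not_lt.1 h) (f.1 x).2.1

theorem measurableSet_lt_one (f : T.carrier) :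
    MeasurableSet[T.measurableSpace] {x | (f.1 x : ℝ) < 1} := by
  have := measurableSet_pos (∼f)
  simpa only [coe_neg, sub_pos] using this

/-- Uniform approximation digit by digit: f is half of f ⊕ f where f ≤ 1/2 and half of 1 + f ⊙ f
where f > 1/2. The latter set is {f ⊙ f > 0}, which is measurable, and each step halves the error.
-/
theorem measurable_coe (f : T.carrier) : Measurable[T.measurableSpace] fun x => (f.1 x : ℝ) := by
  let m := T.measurableSpace
  have key : ∀ n : ℕ, ∀ f : T.carrier, ∃ g : X → ℝ, Measurable g ∧
      ∀ x, |g x - f.1 x| ≤ (1 / 2) ^ n := by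
    intro n
    induction n with
    | zero =>
      intro f
      refine ⟨fun _ => 0, measurable_const, fun x => ?_⟩
      rw [zero_sub, abs_neg, abs_of_nonneg (f.1 x).2.1, pow_zero]
      exact (f.1 x).2.2
    | succ n ih =>
      intro f
      classical
      obtain ⟨g, hg, hg'⟩ := ih (f ⊹ f)
      obtain ⟨k, hk, hk'⟩ := ih (otimes f f)
      refine ⟨fun x => if x ∈ {x | 0 < ((otimes f f).1 x : ℝ)} then (1 + k x) / 2 else g x / 2,
        Measurable.ite (measurableSet_pos _) ((measurable_const.add hk).div_const 2)
          (hg.div_const 2), fun x => ?_⟩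
      have h1 := abs_le.1 (hg' x)
      have h2 := abs_le.1 (hk' x)
      rw [coe_oplus] at h1
      simp only [Set.mem_ofPred_eq, coe_otimes] at h2 ⊢
      rw [pow_succ, abs_le]
      split_ifs with hx
      · have : 0 < (f.1 x : ℝ) + f.1 x - 1 := (lt_max_iff.1 hx).resolve_right (lt_irrefl _)
        rw [max_eq_left this.le] at h2
        constructor <;> linarith [h2.1, h2.2]
      · have : (f.1 x : ℝ) + f.1 x - 1 ≤ 0 := (le_max_left _ _).trans (not_lt.1 hx)
        rw [min_eq_left (by linarith)] at h1
        constructor <;> linarith [h1.1, h1.2]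
  choose g hg hg' using fun n => key n f
  refine measurable_of_tendsto_metrizable hg (tendsto_pi_nhds.2 fun x => ?_)
  rw [tendsto_iff_dist_tendsto_zero]
  exact squeeze_zero (fun _ => dist_nonneg) (fun n => hg' n x)
    (tendsto_pow_atTop_nhds_zero_of_lt_one (by norm_num) (by norm_num))

/-- The decomposition sends f to its restrictions to A and to the complement, f ⊙ χ_A and f ⊙
(χ_A)*; its inverse is ⊕. -/
theorem isCentral_ind {A : Set X} (hA : MeasurableSet[T.measurableSpace] A) :
    IsCentral (ind hA) := by
  have hmem : ∀ {x}, x ∈ A → ((ind hA).1 x : ℝ) = 1 := fun h => ind_of_mem hA h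
  have hnot : ∀ {x}, x ∉ A → ((ind hA).1 x : ℝ) = 0 := fun h => ind_of_notMem hA h
  set e := ind hA
  have h1 : ∀ (f : T.carrier) (x : X), x ∈ A → ((otimes f e).1 x : ℝ) = f.1 x := by
    intro f x hx
    rw [coe_otimes, hmem hx, add_sub_cancel_right, max_eq_left (f.1 x).2.1]
  have h2 : ∀ (f : T.carrier) (x : X), x ∉ A → ((otimes f e).1 x : ℝ) = 0 := by
    intro f x hx
    rw [coe_otimes, hnot hx]
    exact max_eq_right (by linarith [(f.1 x).2.2])
  have h3 : ∀ (f : T.carrier) (x : X), x ∈ A → ((otimes f (∼e)).1 x : ℝ) = 0 := by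
    intro f x hx
    rw [coe_otimes, coe_neg, hmem hx]
    exact max_eq_right (by linarith [(f.1 x).2.2])
  have h4 : ∀ (f : T.carrier) (x : X), x ∉ A → ((otimes f (∼e)).1 x : ℝ) = f.1 x := by
    intro f x hx
    rw [coe_otimes, coe_neg, hnot hx, sub_zero, add_sub_cancel_right, max_eq_left (f.1 x).2.1]
  have h5 : ∀ {f : T.carrier}, f ≤ e → ∀ x ∉ A, (f.1 x : ℝ) = 0 := fun {f} hf x hx =>
    le_antisymm ((le_iff_coe.1 hf x).trans (hnot hx).le) (f.1 x).2.1
  have h6 : ∀ {f : T.carrier}, f ≤ ∼e → ∀ x ∈ A, (f.1 x : ℝ) = 0 := by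
    intro f hf x hx
    have := le_iff_coe.1 hf x
    rw [coe_neg, hmem hx, sub_self] at this
    exact le_antisymm this (f.1 x).2.1
  have h7 : ∀ f : T.carrier, otimes f e ⊹ otimes f (∼e) = f := by
    intro f
    refine ext_coe fun x => ?_
    rw [coe_oplus]
    by_cases hx : x ∈ A
    · rw [h1 f x hx, h3 f x hx, add_zero, min_eq_left (f.1 x).2.2]
    · rw [h2 f x hx, h4 f x hx, zero_add, min_eq_left (f.1 x).2.2]
  have hle : ∀ f g : T.carrier, otimes f g ≤ g := by
    intro f g
    refine le_iff_coe.2 fun x => ?_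
    rw [coe_otimes]
    exact max_le (by linarith [(f.1 x).2.2]) (g.1 x).2.1
  refine ⟨⟨fun f => (⟨otimes f e, hle f e⟩, ⟨otimes f (∼e), hle f (∼e)⟩),
    fun p => p.1.1 ⊹ p.2.1, h7, ?_⟩, ⟨?_, ?_⟩, ?_, ⟨?_, ?_⟩, ?_⟩
  · rintro ⟨⟨f, hf⟩, ⟨g, hg⟩⟩
    refine Prod.ext (Subtype.ext (ext_coe fun x => ?_)) (Subtype.ext (ext_coe fun x => ?_))
    · change ((otimes (f ⊹ g) e).1 x : ℝ) = f.1 x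
      by_cases hx : x ∈ A
      · rw [h1 _ x hx, coe_oplus, h6 hg x hx, add_zero, min_eq_left (f.1 x).2.2]
      · rw [h2 _ x hx, h5 hf x hx]
    · change ((otimes (f ⊹ g) (∼e)).1 x : ℝ) = g.1 x
      by_cases hx : x ∈ A
      · rw [h3 _ x hx, h6 hg x hx]
      · rw [h4 _ x hx, coe_oplus, h5 hf x hx, zero_add, min_eq_left (g.1 x).2.2]
  · change otimes one e = e
    rw [otimes, MVAlgebra.neg_one, zero_oplus, MVAlgebra.neg_neg]
  · change otimes one (∼e) = ∼e
    rw [otimes, MVAlgebra.neg_one, zero_oplus, MVAlgebra.neg_neg]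
  · intro a b c
    change _ ↔ IsSum (otimes a e) (otimes b e) (otimes c e) ∧
      IsSum (otimes a (∼e)) (otimes b (∼e)) (otimes c (∼e))
    simp only [isSum_iff]
    constructor
    · refine fun h => ⟨fun x => ?_, fun x => ?_⟩
      · by_cases hx : x ∈ A
        · rw [h1 _ x hx, h1 _ x hx, h1 _ x hx, h]
        · rw [h2 _ x hx, h2 _ x hx, h2 _ x hx, zero_add]
      · by_cases hx : x ∈ A
        · rw [h3 _ x hx, h3 _ x hx, h3 _ x hx, zero_add]
        · rw [h4 _ x hx, h4 _ x hx, h4 _ x hx, h]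
    · rintro ⟨ha, hb⟩ x
      by_cases hx : x ∈ A
      · rw [← h1 a x hx, ← h1 b x hx, ← h1 c x hx, ha]
      · rw [← h4 a x hx, ← h4 b x hx, ← h4 c x hx, hb]
  · change otimes e e = e
    refine ext_coe fun x => ?_
    by_cases hx : x ∈ A
    · rw [h1 e x hx]
    · rw [h2 e x hx, hnot hx]
  · change otimes e (∼e) = zero
    rw [otimes_eq_zero, MVAlgebra.neg_neg]
  · intro f
    refine ⟨(hle f e).trans ?_, h7 f⟩
    rw [le_neg_comm]
    exact hle f (∼e)

variable (T) in
theorem B₀_eq_S₀ : T.B₀ = T.S₀ := by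
  ext A
  constructor
  · rintro ⟨e, he, -⟩
    change chi A ∈ T.carrier
    rw [← he]; exact e.2
  · intro hA
    exact ⟨_, rfl, isCentral_ind hA⟩

end Chi

/-! ### States on tribes as integrals. -/

section StatesOnTribes

variable {T}

/-- With g = (f ⊕ f) ⊖ f = min(f, 1 - f), both f ⊕ f = f + g and f = f ⊙ f + g are partial sums. -/
theorem two_mul_state {t : T.carrier → ℝ} (ht : IsState t) (f : T.carrier) :
    2 * t f = t (f ⊹ f) + t (otimes f f) := by
  have h1 := ht.map_sum f (sub (f ⊹ f) f) (f ⊹ f) (isSum_iff.2 fun x => by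
    rw [coe_sub, coe_oplus]
    have := (f.1 x).2
    grind)
  have h2 := ht.map_sum (otimes f f) (sub (f ⊹ f) f) f (isSum_iff.2 fun x => by
    rw [coe_sub, coe_oplus, coe_otimes]
    have := (f.1 x).2
    grind)
  linarith

theorem measurableSet_pos_lt_one (f : T.carrier) :
    MeasurableSet[T.measurableSpace] {x | 0 < (f.1 x : ℝ) ∧ (f.1 x : ℝ) < 1} :=
  (measurableSet_pos f).inter (measurableSet_lt_one f)

/-- A state on a tribe is determined by its values at characteristic functions. -/
theorem state_ext {t t' : T.carrier → ℝ} (ht : IsState t) (ht' : IsState t')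
    (h : ∀ A (hA : MeasurableSet[T.measurableSpace] A), t (ind hA) = t' (ind hA)) : t = t' := by
  -- The bound is weighted by {0 < f < 1}. The corresponding sets for f ⊕ f and f ⊙ f are disjoint
  -- subsets of it, so `two_mul_state` combines the two errors without enlarging the weight and
  -- gains a factor 1/2.
  have key : ∀ n : ℕ, ∀ f : T.carrier,
      |t f - t' f| ≤ t (ind (measurableSet_pos_lt_one f)) * (1 / 2) ^ n := by
    intro n
    induction n with
    | zero =>
      intro f
      have hB := measurableSet_pos_lt_one f
      have h1 : MeasurableSet[T.measurableSpace] {x | (f.1 x : ℝ) < 1}ᶜ :=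
        (measurableSet_lt_one f).compl
      -- Split off χ of {f = 1}, where the states agree; the rest is dominated by χ of {0 < f < 1}.
      have hsum : IsSum (ind h1) (sub f (ind h1)) f := by
        refine isSum_iff.2 fun x => ?_
        rw [coe_sub]
        by_cases hx : (f.1 x : ℝ) < 1
        · rw [ind_of_notMem h1 (fun h => h hx)]
          have := (f.1 x).2.1
          grind
        · rw [ind_of_mem h1 hx]
          have := (f.1 x).2.2
          grind
      have hle : sub f (ind h1) ≤ ind hB := by
        refine le_iff_coe.2 fun x => ?_
        rw [coe_sub]
        refine max_le ?_ ((ind hB).1 x).2.1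
        by_cases hx : (f.1 x : ℝ) < 1
        · rw [ind_of_notMem h1 (fun h => h hx), sub_zero]
          by_cases hx0 : 0 < (f.1 x : ℝ)
          · rw [ind_of_mem hB ⟨hx0, hx⟩]; exact hx.le
          · exact (not_lt.1 hx0).trans ((ind hB).1 x).2.1
        · rw [ind_of_mem h1 hx]
          linarith [(f.1 x).2.2, ((ind hB).1 x).2.1]
      have e1 := ht.map_sum _ _ _ hsum
      have e2 := ht'.map_sum _ _ _ hsum
      have l1 := ht.mono hle
      have l2 := ht'.mono hle
      rw [← h _ h1] at e2
      rw [← h _ hB] at l2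
      rw [pow_zero, mul_one, abs_le]
      constructor <;> linarith [(ht.mem_Icc (sub f (ind h1))).1, (ht'.mem_Icc (sub f (ind h1))).1]
    | succ n ih =>
      intro f
      have hB := measurableSet_pos_lt_one f
      have hB1 := measurableSet_pos_lt_one (f ⊹ f)
      have hB2 := measurableSet_pos_lt_one (otimes f f)
      have m1 : ∀ x, x ∈ {x | 0 < ((f ⊹ f).1 x : ℝ) ∧ ((f ⊹ f).1 x : ℝ) < 1} →
          0 < (f.1 x : ℝ) ∧ (f.1 x : ℝ) < 1 / 2 := by
        intro x hx
        have hx' := hx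
        simp only [Set.mem_ofPred_eq, coe_oplus] at hx'
        grind
      have m2 : ∀ x, x ∈ {x | 0 < ((otimes f f).1 x : ℝ) ∧ ((otimes f f).1 x : ℝ) < 1} →
          1 / 2 < (f.1 x : ℝ) ∧ (f.1 x : ℝ) < 1 := by
        intro x hx
        have hx' := hx
        simp only [Set.mem_ofPred_eq, coe_otimes] at hx'
        grind
      have hpt : ∀ x, ((ind hB1).1 x : ℝ) + (ind hB2).1 x ≤ (ind hB).1 x := by
        intro x
        by_cases hx1 : x ∈ {x | 0 < ((f ⊹ f).1 x : ℝ) ∧ ((f ⊹ f).1 x : ℝ) < 1}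
        · have h1 := m1 x hx1
          have hx2 : x ∉ {x | 0 < ((otimes f f).1 x : ℝ) ∧ ((otimes f f).1 x : ℝ) < 1} :=
            fun hx2 => by linarith [(m2 x hx2).1]
          rw [ind_of_mem hB1 hx1, ind_of_notMem hB2 hx2,
            ind_of_mem hB ⟨h1.1, by linarith [h1.2]⟩, add_zero]
        · rw [ind_of_notMem hB1 hx1, zero_add]
          by_cases hx2 : x ∈ {x | 0 < ((otimes f f).1 x : ℝ) ∧ ((otimes f f).1 x : ℝ) < 1}
          · have h2 := m2 x hx2
            rw [ind_of_mem hB2 hx2, ind_of_mem hB ⟨by linarith [h2.1], h2.2⟩]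
          · rw [ind_of_notMem hB2 hx2]; exact ((ind hB).1 x).2.1
      have hle : t (ind hB1) + t (ind hB2) ≤ t (ind hB) := by
        rw [← ht.map_sum (ind hB1) (ind hB2) (ind hB1 ⊹ ind hB2)]
        · refine ht.mono (le_iff_coe.2 fun x => ?_)
          rw [coe_oplus]
          exact (min_le_left _ _).trans (hpt x)
        · refine isSum_iff.2 fun x => ?_
          rw [coe_oplus, min_eq_left]
          exact (hpt x).trans ((ind hB).1 x).2.2
      have i1 := abs_le.1 (ih (f ⊹ f))
      have i2 := abs_le.1 (ih (otimes f f))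
      have e1 := two_mul_state ht f
      have e2 := two_mul_state ht' f
      have hpos : (0 : ℝ) < (1 / 2) ^ n := by positivity
      have hle' := mul_le_mul_of_nonneg_right hle hpos.le
      rw [pow_succ, abs_le]
      constructor <;> linarith [i1.1, i1.2, i2.1, i2.2]
  funext f
  linarith [eq_zero_of_abs_le_half_pow fun n => key n f]

/-- For disjoint sets the truncated partial sums of characteristic functions are genuine partial
sums, and they increase to that of the union. -/
theorem hasSum_state_ind {t : T.carrier → ℝ} (ht : IsSigmaAdditiveState t) {A : ℕ → Set X}
    (hA : ∀ n, MeasurableSet[T.measurableSpace] (A n)) (hd : Pairwise (Function.onFun Disjoint A))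
    (hU : MeasurableSet[T.measurableSpace] (⋃ n, A n)) :
    HasSum (fun n => t (ind (hA n))) (t (ind hU)) := by
  rw [hasSum_iff_tendsto_nat_of_nonneg fun n => (ht.mem_Icc _).1]
  have h1 : IsLUB (Set.range (psum fun n => ind (hA n))) (ind hU) :=
    isLUB_psum fun x => congrFun (chi_iUnion A) x
  have h2 := ht.tendsto _ _ (monotone_nat_of_le_succ fun n => le_oplus_right _ _) h1
  convert h2 using 2 with n
  induction n with
  | zero => rw [Finset.sum_range_zero, psum, ht.map_zero]
  | succ n ih =>
    rw [Finset.sum_range_succ, ih, psum]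
    refine (ht.map_sum _ _ _ ⟨le_iff_coe.2 fun x => ?_, rfl⟩).symm
    rw [coe_neg, psum_apply, coe_psum]
    by_cases hx : x ∈ A n
    · rw [ind_of_mem (hA n) hx, Finset.sum_eq_zero]
      · norm_num
      · intro i hi
        have hin : i ≠ n := (Finset.mem_range.1 hi).ne
        exact ind_of_notMem (hA i) fun hxi => Set.disjoint_left.1 (hd hin) hxi hx
    · rw [ind_of_notMem (hA n) hx, sub_zero]
      exact min_le_right _ _

/-- The measure `A ↦ t (χ_A)` of a σ-additive state on a tribe. -/
noncomputable def stateMeasure {t : T.carrier → ℝ} (ht : IsSigmaAdditiveState t) :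
    @MeasureTheory.Measure X T.measurableSpace :=
  @MeasureTheory.Measure.ofMeasurable X T.measurableSpace
    (fun _ hA => ENNReal.ofReal (t (ind hA)))
    (by
      have : ind (@MeasurableSet.empty X T.measurableSpace) = zero :=
        ext_coe fun x => by rw [ind_of_notMem _ (Set.notMem_empty x), coe_zero]
      rw [this, ht.map_zero, ENNReal.ofReal_zero])
    (by
      intro A hA hd
      have h := hasSum_state_ind ht hA hd (MeasurableSet.iUnion hA)
      rw [← h.tsum_eq, ENNReal.ofReal_tsum_of_nonneg (fun n => (ht.mem_Icc _).1) h.summable])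

theorem stateMeasure_apply {t : T.carrier → ℝ} (ht : IsSigmaAdditiveState t) {A : Set X}
    (hA : MeasurableSet[T.measurableSpace] A) :
    stateMeasure ht A = ENNReal.ofReal (t (ind hA)) :=
  @MeasureTheory.Measure.ofMeasurable_apply X T.measurableSpace _ _ _ A hA

theorem ind_univ : ind (@MeasurableSet.univ X T.measurableSpace) = (one : T.carrier) :=
  ext_coe fun x => by rw [ind_of_mem _ (Set.mem_univ x), coe_one]

theorem isProbabilityMeasure_stateMeasure {t : T.carrier → ℝ} (ht : IsSigmaAdditiveState t) :
    MeasureTheory.IsProbabilityMeasure (stateMeasure ht) :=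
  ⟨by rw [stateMeasure_apply ht MeasurableSet.univ, ind_univ, ht.map_one, ENNReal.ofReal_one]⟩

theorem integrable_coe {m : MeasurableSpace X} (hm : m = T.measurableSpace)
    (μ : MeasureTheory.Measure X) [MeasureTheory.IsProbabilityMeasure μ] (f : T.carrier) :
    MeasureTheory.Integrable (fun x => (f.1 x : ℝ)) μ := by
  subst hm
  refine MeasureTheory.Integrable.of_bound (measurable_coe f).aestronglyMeasurable 1
    (Filter.Eventually.of_forall fun x => ?_)
  rw [Real.norm_of_nonneg (f.1 x).2.1]
  exact (f.1 x).2.2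

theorem integral_ind {m : MeasurableSpace X} (hm : m = T.measurableSpace)
    (μ : MeasureTheory.Measure X) {A : Set X} (hA : MeasurableSet[T.measurableSpace] A) :
    ∫ x, ((ind hA).1 x : ℝ) ∂μ = μ.real A := by
  subst hm
  have : (fun x => ((ind hA).1 x : ℝ)) = A.indicator fun _ => (1 : ℝ) := by
    funext x
    by_cases hx : x ∈ A
    · rw [ind_of_mem hA hx, Set.indicator_of_mem hx]
    · rw [ind_of_notMem hA hx, Set.indicator_of_notMem hx]
  rw [this, MeasureTheory.integral_indicator_const _ hA, smul_eq_mul, mul_one]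

theorem isState_integral {m : MeasurableSpace X} (hm : m = T.measurableSpace)
    (μ : MeasureTheory.Measure X) [MeasureTheory.IsProbabilityMeasure μ] :
    IsState fun f : T.carrier => ∫ x, (f.1 x : ℝ) ∂μ where
  mem_Icc f := by
    refine ⟨MeasureTheory.integral_nonneg fun x => (f.1 x).2.1, ?_⟩
    have := MeasureTheory.integral_mono (integrable_coe hm μ f) (MeasureTheory.integrable_const 1)
      fun x => (f.1 x).2.2
    simpa using this
  map_one := by simp only [coe_one]; simp
  map_sum f g k h := by
    rw [← MeasureTheory.integral_add (integrable_coe hm μ f) (integrable_coe hm μ g)]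
    simp only [isSum_iff.1 h]

/-- A σ-additive state on a tribe is the integral with respect to a unique probability measure. -/
theorem existsUnique_measure {t : T.carrier → ℝ} (ht : IsSigmaAdditiveState t) :
    ∃! μ : @MeasureTheory.Measure X T.measurableSpace,
      MeasureTheory.IsProbabilityMeasure μ ∧
      ∀ f : T.carrier, t f = @MeasureTheory.integral X ℝ _ _ T.measurableSpace μ
        fun x => (f.1 x : ℝ) := by
  refine ⟨stateMeasure ht, ⟨isProbabilityMeasure_stateMeasure ht, ?_⟩, ?_⟩
  · have := isProbabilityMeasure_stateMeasure ht
    refine congrFun (state_ext ht.toIsState (isState_integral rfl (stateMeasure ht)) ?_)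
    intro A hA
    rw [integral_ind rfl, MeasureTheory.measureReal_def, stateMeasure_apply ht hA,
      ENNReal.toReal_ofReal (ht.mem_Icc _).1]
  · rintro μ ⟨hμ, h⟩
    refine @MeasureTheory.Measure.ext X T.measurableSpace _ _ fun A hA => ?_
    rw [stateMeasure_apply ht hA, h, integral_ind rfl, MeasureTheory.ofReal_measureReal]

end StatesOnTribes

end Tribe

theorem mainTheorem7 {M : Type u} [MVAlgebra M] (hM : MVAlgebra.IsSigmaComplete M)
    (s : M → ℝ) (hs : MVAlgebra.IsSigmaAdditiveState s) :
    ∃ (X : Type u) (_ : Nonempty X) (T : Tribe X) (h : T.carrier → M),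
      MVAlgebra.IsSigmaHom h ∧ Function.Surjective h ∧
      T.B₀ = T.S₀ ∧
      ∃ m : MeasurableSpace X,
        {A : Set X | MeasurableSet[m] A} = T.B₀ ∧
        (∀ f : T.carrier, Measurable[m] fun x => (f.1 x : ℝ)) ∧
        ∃! μ : @MeasureTheory.Measure X m,
          MeasureTheory.IsProbabilityMeasure μ ∧
          ∀ (a : M) (f : T.carrier), h f = a → s a = ∫ x, (f.1 x : ℝ) ∂μ := by
  -- The state takes different values at 0 and 1, so `M` is nontrivial and its spectrum is nonempty.
  have h01 : (MVAlgebra.one : M) ≠ MVAlgebra.zero := by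
    intro h
    have h1 := hs.map_one
    rw [h, hs.map_zero] at h1
    norm_num at h1
  obtain ⟨x, hx, -⟩ := MVAlgebra.exists_isHom_ne_zero hM h01
  refine ⟨MVAlgebra.Spec M, ⟨⟨x, hx⟩⟩, MVAlgebra.specTribe hM, MVAlgebra.specHom hM,
    MVAlgebra.isSigmaHom_specHom hM, MVAlgebra.specHom_surjective hM, Tribe.B₀_eq_S₀ _,
    (MVAlgebra.specTribe hM).measurableSpace, (Tribe.B₀_eq_S₀ _).symm, Tribe.measurable_coe, ?_⟩
  have h := Tribe.existsUnique_measure (hs.comp (MVAlgebra.isSigmaHom_specHom hM))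
  refine (existsUnique_congr fun μ => and_congr_right fun _ => ?_).1 h
  exact ⟨fun hf a f ha => ha ▸ hf f, fun hf f => hf _ f rfl⟩
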